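/- Let $F=\mathbb{Q}(\alpha)$ and let $\Lambda_F=F[p_1,p_2,\dots]$ be the ring of symmetric functions over $F$, with power sums $p_k$, monomial symmetric functions $m_\lambda$, and the scalar product $\langle p_\lambda,p_\mu\rangle=\delta_{\lambda\mu}\,\alpha^{l(\lambda)}z_\lambda$, where $l(\lambda)$ is the number of parts of $\lambda$, $z_\lambda=\prod_{i\ge1}i^{m_i(\lambda)}m_i(\lambda)!$ and $m_i(\lambda)$ is the multiplicity of $i$ as a part of $\lambda$. Let $P_\lambda$ be the Jack symmetric functions, i.e. the family with $P_\lambda\in m_\lambda+\sum_{\mu<\lambda}F m_\mu$ (dominance order) and $\langle P_\lambda,P_\mu\rangle=0$ for $\lambda\ne\mu$; let $Q_\lambda=\langle P_\lambda,P_\lambda\rangle^{-1}P_\lambda$, and let $J_\lambda=\sum_{\nu\le\lambda}v_{\lambda\nu}(\alpha)m_\nu$ be the scalar multiple of $P_\lambda$ with $v_{\lambda,(1^{|\lambda|})}=|\lambda|!$. For a partition $\lambda=(\lambda_1\ge\lambda_2\ge\cdots)$ put $e'_\lambda=\frac{\alpha}{2}\sum_i\lambda_i^2-\sum_i i\lambda_i$.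 For $i<j$ and $0<k\le\lambda_j$ let $r^i_j(k).\lambda$ be the partition obtained from $\lambda$ by replacing $\lambda_i,\lambda_j$ by $\lambda_i+k,\lambda_j-k$ and rearranging in decreasing order. Let $M^*(\lambda)$ be the set of all partitions so obtained, and for $\mu=r^i_j(k).\lambda$ put $$r_{\lambda\mu}=(1+\delta_{\lambda_i\lambda_j})^{-1}\,m_{\lambda_i}(\lambda)\,\bigl(m_{\lambda_j}(\lambda)-\delta_{\lambda_i\lambda_j}\bigr)\,(\lambda_i-\lambda_j+2k),$$ which depends only on $\lambda$ and $\mu$. A moving up filtration is a sequence $\delta=(\lambda^0,\lambda^1,\dots,\lambda^s)$, $s\ge0$, of partitions with $\lambda^{i}\in M^*(\lambda^{i-1})$ for $1\le i\le s$; write $st(\delta)=\lambda^0$, $ed(\delta)=\lambda^s$, and $$f^\lambda(\delta)=\prod_{i=0}^{s-1}\frac{r_{\lambda^i\lambda^{i+1}}}{e'_\lambda-e'_{\lambda^i}},\qquad f_\mu(\delta)=\prod_{i=0}^{s-1}\frac{r_{\lambda^i\lambda^{i+1}}}{e'_\mu-e'_{\lambda^{i+1}}}.$$ Theorem. For all partitions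 $\lambda,\mu,\nu$, $$\langle Q_\mu Q_\nu,J_\lambda\rangle=v_{\lambda\lambda}(\alpha)\sum_{(\delta_1,\delta_2,\delta)}f_\mu(\delta_1)\,f_\nu(\delta_2)\,f^\lambda(\delta),$$ where the sum is over the (finitely many) triples of moving up filtrations with $st(\delta_1)=\mu$, $st(\delta_2)=\nu$, $ed(\delta)=\lambda$ and $st(\delta)=ed(\delta_1)\cup ed(\delta_2)$, and $\cup$ denotes the union of partitions as multisets of parts. -/

import Mathlib

namespace JackLR

open scoped Classical

noncomputable section

/-! ### Partitions -/

/-- A partition, given by the multiset of its (nonzero) parts. -/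
@[ext]
structure Ptn where
  parts : Multiset ℕ
  pos : ∀ i ∈ parts, 0 < i

namespace Ptn

/-- The parts `λ₁ ≥ λ₂ ≥ ⋯ ≥ λ_l` in decreasing order. -/
def rows (l : Ptn) : List ℕ := l.parts.sort (fun a b => a ≥ b)

/-- The `i`-th part, rows being indexed from `0`; it is `0` beyond the length. -/
def row (l : Ptn) (i : ℕ) : ℕ := l.rows.getD i 0

/-- The weight `|λ|`. -/
def weight (l : Ptn) : ℕ := l.parts.sum

/-- The length `l(λ)`. -/
def length (l : Ptn) : ℕ := l.parts.card

/-- The multiplicity `m_a(λ)` of `a` among the parts. -/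
def mult (l : Ptn) (a : ℕ) : ℕ := l.parts.count a

/-- The partition `(1^n)`. -/
def ones (n : ℕ) : Ptn where
  parts := Multiset.replicate n 1
  pos := fun i hi => by rw [Multiset.eq_of_mem_replicate hi]; exact Nat.one_pos

/-- The union of two partitions: the parts of both, with multiplicities added. -/
def union (l m : Ptn) : Ptn where
  parts := l.parts + m.parts
  pos := fun i hi => (Multiset.mem_add.1 hi).elim (l.pos i) (m.pos i)

/-- The dominance order on partitions of the same weight; `Dominated m l` means `m ≤ l`. -/
def Dominated (m l : Ptn) : Prop :=
  m.weight = l.weight ∧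
    ∀ n, ∑ t ∈ Finset.range n, m.row t ≤ ∑ t ∈ Finset.range n, l.row t

/-- The partition obtained from a list of natural numbers by rearranging it and dropping zeros. -/
def ofList (L : List ℕ) : Ptn where
  parts := (L : Multiset ℕ).filter (fun a => 0 < a)
  pos := fun _ hi => (Multiset.mem_filter.1 hi).2

/-- Moving `k` squares from row `j` to row `i`, then rearranging the rows. -/
def moveUp (l : Ptn) (i j k : ℕ) : Ptn :=
  ofList ((l.rows.set i (l.row i + k)).set j (l.row j - k))

/-- `(i, j, k)` is a moving up operator of `l`: `i < j` and `0 < k ≤ l_j`. The last condition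
forces `j`, hence `i`, to be (the index of) an actual row. -/
def IsMove (l : Ptn) (i j k : ℕ) : Prop := i < j ∧ 0 < k ∧ k ≤ l.row j

/-- The moving up `M^*(λ)` of `λ`. -/
def movingUp (l : Ptn) : Set Ptn := {m | ∃ i j k, l.IsMove i j k ∧ l.moveUp i j k = m}

end Ptn

/-! ### Symmetric functions over `ℚ(α)` -/

/-- The field `F = ℚ(α)` of rational functions. -/
abbrev F : Type := RatFunc ℚ

/-- The indeterminate `α`. -/
abbrev α : F := RatFunc.X

/-- `Λ_F = F[p₁, p₂, …]`, the ring of symmetric functions as the polynomial ring in the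
power sums; the variable `X k` is `p_k`. -/
abbrev Sym : Type := MvPolynomial ℕ+ F

/-- The power sum `∑ᵢ xᵢ^k` as a formal series in the variables `x₀, x₁, …`. -/
def psumSeries (k : ℕ+) : MvPowerSeries ℕ F :=
  fun d => if ∃ i : ℕ, d = Finsupp.single i (k : ℕ) then 1 else 0

/-- The formal series in `x₀, x₁, …` that a symmetric function stands for. -/
def toSeries : Sym →ₐ[F] MvPowerSeries ℕ F := MvPolynomial.aeval psumSeries

/-- The monomial symmetric function `m_μ`: the sum of all distinct monomials whose multiset of
nonzero exponents is the multiset of parts of `μ`. -/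
def monomialSeries (m : Ptn) : MvPowerSeries ℕ F :=
  fun d => if d.support.val.map (fun i => d i) = m.parts then 1 else 0

/-- The coefficient of `m_μ` in a symmetric function, that is the coefficient of
`x₀^{μ₁} x₁^{μ₂} ⋯`. -/
def mCoeff (m : Ptn) (f : Sym) : F := MvPowerSeries.coeff m.rows.toFinsupp (toSeries f)

/-- `α^{l(λ)} z_λ` for the partition `λ = (1^{d 1} 2^{d 2} ⋯)`, where
`z_λ = ∏ i^{d i} (d i)!`. -/
def normSq (d : ℕ+ →₀ ℕ) : F :=
  α ^ (d.sum fun _ a => a) * (d.prod fun i a => ((i : ℕ) : F) ^ a * (Nat.factorial a : F))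

/-- The Jack scalar product: the bilinear form with
`⟨p_λ, p_μ⟩ = δ_{λμ} α^{l(λ)} z_λ`. -/
def inner (f g : Sym) : F :=
  ∑ d ∈ f.support, MvPolynomial.coeff d f * MvPolynomial.coeff d g * normSq d

theorem inner_monomial (d e : ℕ+ →₀ ℕ) :
    inner (MvPolynomial.monomial d 1) (MvPolynomial.monomial e 1) =
      if d = e then normSq d else 0 := by
  rw [inner, MvPolynomial.support_monomial, if_neg one_ne_zero, Finset.sum_singleton,
    MvPolynomial.coeff_monomial, MvPolynomial.coeff_monomial]
  by_cases h : d = e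
  · simp [h]
  · simp [h, Ne.symm h]

/-! ### Jack functions -/

/-- The defining property of the Jack functions `P_λ`: `P_λ = ∑_{μ ≤ λ} c_{λμ} m_μ` with
`c_{λλ} = 1`, and `⟨P_λ, P_μ⟩ = 0` for `λ ≠ μ`. There is exactly one such family. -/
def IsJackFamily (P : Ptn → Sym) : Prop :=
  (∀ l, ∃ c : Ptn →₀ F, (∀ m ∈ c.support, m.Dominated l) ∧ c l = 1 ∧
    toSeries (P l) = c.sum fun m a => a • monomialSeries m) ∧
  ∀ l m, l ≠ m → inner (P l) (P m) = 0

/-- The Jack functions `P_λ(α)`. -/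
def jackP : Ptn → Sym :=
  if h : ∃ P, IsJackFamily P then h.choose else 0

/-- The dual Jack functions `Q_λ(α) = ⟨P_λ, P_λ⟩⁻¹ P_λ`. -/
def jackQ (l : Ptn) : Sym := (inner (jackP l) (jackP l))⁻¹ • jackP l

/-- The Jack functions `J_λ(α)`, normalized so that the coefficient of `m_{(1^n)}`, with
`n = |λ|`, is `n!`. -/
def jackJ (l : Ptn) : Sym :=
  ((Nat.factorial l.weight : F) / mCoeff (Ptn.ones l.weight) (jackP l)) • jackP l

/-- The coefficient `v_{λν}(α)` of `m_ν` in `J_λ(α)`. -/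
def v (l n : Ptn) : F := mCoeff n (jackJ l)

/-! ### Moving up filtrations -/

/-- `e'_λ(α) = (α / 2) ∑ᵢ λᵢ² - ∑ᵢ i λᵢ`, with `i = 1, 2, …`. -/
def e' (l : Ptn) : F :=
  α / 2 * ∑ t ∈ Finset.range l.length, (l.row t : F) ^ 2
    - ∑ t ∈ Finset.range l.length, ((t : F) + 1) * (l.row t : F)

/-- The value `(1 + δ_{ab})⁻¹ m_a(λ) (m_b(λ) - δ_{ab}) (a - b + 2k)`, where `a = λ_i`,
`b = λ_j`. -/
def moveCoeff (l : Ptn) (i j k : ℕ) : F :=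
  (1 + if l.row i = l.row j then 1 else 0)⁻¹ * (l.mult (l.row i) : F) *
    ((l.mult (l.row j) : F) - if l.row i = l.row j then 1 else 0) *
    ((l.row i : F) - (l.row j : F) + 2 * (k : F))

theorem Ptn.count_set (L : List ℕ) (i x w : ℕ) (hi : i < L.length) :
    (L.set i x).count w + (if L.getD i 0 = w then 1 else 0) =
      L.count w + (if x = w then 1 else 0) := by
  have h1 := (List.set_perm_cons_eraseIdx hi x).count_eq w
  have h2 := (List.getElem_cons_eraseIdx_perm hi).count_eq w
  rw [List.count_cons] at h1 h2
  simp only [beq_iff_eq] at h1 h2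
  rw [List.getD_eq_getElem _ _ hi]
  omega

theorem Ptn.row_antitone (l : Ptn) {i j : ℕ} (h : i < j) : l.row j ≤ l.row i := by
  unfold Ptn.row
  by_cases hj : j < l.rows.length
  · rw [List.getD_eq_getElem _ _ hj, List.getD_eq_getElem _ _ (h.trans hj)]
    exact List.pairwise_iff_getElem.1 (Multiset.pairwise_sort _ _) i j (h.trans hj) hj h
  · rw [List.getD_eq_default _ _ (not_lt.1 hj)]
    exact Nat.zero_le _

theorem Ptn.count_moveUp (l : Ptn) {i j k : ℕ} (h : l.IsMove i j k) (w : ℕ) (hw : 0 < w) :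
    (l.moveUp i j k).parts.count w + (if l.row i = w then 1 else 0) +
      (if l.row j = w then 1 else 0) =
    l.parts.count w + (if l.row i + k = w then 1 else 0) +
      (if l.row j - k = w then 1 else 0) := by
  obtain ⟨hij, hk, hkj⟩ := h
  have hj : j < l.rows.length := by
    by_contra hj
    have : l.row j = 0 := List.getD_eq_default _ _ (not_lt.1 hj)
    omega
  have h1 := Ptn.count_set l.rows i (l.row i + k) w (hij.trans hj)
  have h2 := Ptn.count_set (l.rows.set i (l.row i + k)) j (l.row j - k) w (by simpa using hj)
  have h3 : (l.rows.set i (l.row i + k)).getD j 0 = l.row j := by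
    simp [Ptn.row, List.getD_eq_getElem?_getD, hij.ne]
  have h4 : l.rows.count w = l.parts.count w := by
    rw [← Multiset.coe_count, Ptn.rows, Multiset.sort_eq]
  rw [h3] at h2
  have h5 : (l.moveUp i j k).parts.count w =
      ((l.rows.set i (l.row i + k)).set j (l.row j - k)).count w := by
    rw [Ptn.moveUp, Ptn.ofList, Multiset.count_filter_of_pos (p := fun a => 0 < a) hw,
      Multiset.coe_count]
  change _ + (if l.row i = w then 1 else 0) = _ at h1
  omega

/-- A partition and its image under a moving up operator determine the three numbers that
`moveCoeff` is made of. -/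
theorem Ptn.move_unique (l : Ptn) {i j k i' j' k' : ℕ} (h : l.IsMove i j k)
    (h' : l.IsMove i' j' k') (he : l.moveUp i j k = l.moveUp i' j' k') :
    l.row i = l.row i' ∧ l.row j = l.row j' ∧ k = k' := by
  have key : ∀ w, 0 < w → (if l.row i + k = w then 1 else 0) + (if l.row j - k = w then 1 else 0) +
      (if l.row i' = w then 1 else 0) + (if l.row j' = w then 1 else 0) =
      (if l.row i' + k' = w then 1 else 0) + (if l.row j' - k' = w then 1 else 0) +
      (if l.row i = w then 1 else 0) + (if l.row j = w then 1 else 0) := by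
    intro w hw
    have h1 := l.count_moveUp h w hw
    have h2 := l.count_moveUp h' w hw
    rw [he] at h1
    omega
  have ha := l.row_antitone h.1
  have ha' := l.row_antitone h'.1
  obtain ⟨-, hk, hkj⟩ := h
  obtain ⟨-, hk', hkj'⟩ := h'
  generalize l.row i = a at *
  generalize l.row j = b at *
  generalize l.row i' = a' at *
  generalize l.row j' = b' at *
  have e1 : a + k = a' + k' := by
    rcases lt_trichotomy (a + k) (a' + k') with h | h | h
    · have q := key (a' + k') (by omega)
      rw [if_neg (by omega), if_neg (by omega), if_neg (by omega), if_neg (by omega),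
        if_pos rfl] at q
      omega
    · exact h
    · have q := key (a + k) (by omega)
      rw [if_pos rfl, if_neg (show ¬ a' + k' = a + k by omega),
        if_neg (show ¬ b' - k' = a + k by omega), if_neg (show ¬ a = a + k by omega),
        if_neg (show ¬ b = a + k by omega)] at q
      omega
  have e2 : a = a' := by
    rcases lt_trichotomy a a' with h | h | h
    · have q := key a' (by omega)
      rw [if_pos (show a' = a' from rfl), if_neg (show ¬ a' + k' = a' by omega),
        if_neg (show ¬ b' - k' = a' by omega), if_neg (show ¬ a = a' by omega),
        if_neg (show ¬ b = a' by omega)] at q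
      omega
    · exact h
    · have q := key a (by omega)
      rw [if_pos (show a = a from rfl), if_neg (show ¬ a + k = a by omega),
        if_neg (show ¬ b - k = a by omega), if_neg (show ¬ a' = a by omega),
        if_neg (show ¬ b' = a by omega)] at q
      omega
  have e4 : k = k' := by omega
  subst e2 e4
  have e3 : b = b' := by
    rcases lt_trichotomy b b' with h | h | h
    · have q := key b' (by omega)
      rw [if_pos (show b' = b' from rfl), if_neg (show ¬ b' - k = b' by omega),
        if_neg (show ¬ b = b' by omega)] at q
      omega
    · exact h
    · have q := key b (by omega)
      rw [if_pos (show b = b from rfl), if_neg (show ¬ b - k = b by omega),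
        if_neg (show ¬ b' = b by omega)] at q
      omega
  exact ⟨rfl, e3, rfl⟩

/-- `r_{λμ}`: the value `moveCoeff l i j k` if `μ` is obtained from `λ` by the moving up operator
`(i, j, k)`, `e'_λ` if `μ = λ`, and `0` otherwise. By `r_moveUp` below the first case does not
depend on the choice of `(i, j, k)`. -/
def r (l m : Ptn) : F :=
  if h : ∃ t : ℕ × ℕ × ℕ, l.IsMove t.1 t.2.1 t.2.2 ∧ l.moveUp t.1 t.2.1 t.2.2 = m then
    moveCoeff l h.choose.1 h.choose.2.1 h.choose.2.2
  else if l = m then e' l else 0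

theorem r_moveUp (l : Ptn) (i j k : ℕ) (h : l.IsMove i j k) :
    r l (l.moveUp i j k) = moveCoeff l i j k := by
  have hex : ∃ t : ℕ × ℕ × ℕ, l.IsMove t.1 t.2.1 t.2.2 ∧
      l.moveUp t.1 t.2.1 t.2.2 = l.moveUp i j k := ⟨(i, j, k), h, rfl⟩
  obtain ⟨e1, e2, e3⟩ := l.move_unique hex.choose_spec.1 h hex.choose_spec.2
  rw [r, dif_pos hex, moveCoeff, moveCoeff, e1, e2, e3]

/-- A moving up filtration `(λ⁰, λ¹, …, λˢ)`: each `λⁱ⁺¹` is in `M^*(λⁱ)`. -/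
structure Filtration where
  s : ℕ
  seq : Fin (s + 1) → Ptn
  step : ∀ i : Fin s, seq i.succ ∈ (seq i.castSucc).movingUp

namespace Filtration

/-- The initial partition. -/
def st (δ : Filtration) : Ptn := δ.seq 0

/-- The last partition. -/
def ed (δ : Filtration) : Ptn := δ.seq (Fin.last δ.s)

/-- `f^λ(δ) = ∏_{i < s} r_{λⁱ λⁱ⁺¹} / (e'_λ - e'_{λⁱ})`. -/
def fUpper (l : Ptn) (δ : Filtration) : F :=
  ∏ i : Fin δ.s, r (δ.seq i.castSucc) (δ.seq i.succ) / (e' l - e' (δ.seq i.castSucc))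

/-- `f_μ(δ) = ∏_{i < s} r_{λⁱ λⁱ⁺¹} / (e'_μ - e'_{λⁱ⁺¹})`. -/
def fLower (m : Ptn) (δ : Filtration) : F :=
  ∏ i : Fin δ.s, r (δ.seq i.castSucc) (δ.seq i.succ) / (e' m - e' (δ.seq i.succ))

end Filtration

/-- The triples `(δ₁, δ₂, δ)` with `st δ₁ = μ`, `st δ₂ = ν`, `ed δ = λ` and
`st δ = ed δ₁ ∪ ed δ₂`. -/
def triples (m n l : Ptn) : Set (Filtration × Filtration × Filtration) :=
  {t | t.1.st = m ∧ t.2.1.st = n ∧ t.2.2.ed = l ∧ t.2.2.st = t.1.ed.union t.2.1.ed}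

end

end JackLR

namespace JackLR

open scoped Classical

noncomputable section

open MvPolynomial

/-! ### Power sums, their adjoints, and the dual complete functions -/

/-! Let $\sum_n g_nz^n=\exp\sum_k p_kz^k/(\alpha k)$ and $g_\lambda=\prod_i g_{\lambda_i}$. The
$g_\lambda$ form the basis dual to the $m_\lambda$ (`form_gP_mP`), and $g_\lambda
g_\mu=g_{\lambda\cup\mu}$. The theorem combines this multiplicativity with two expansions:
$Q_\mu=\sum f_\mu(\delta)\,g_{ed(\delta)}$ over filtrations starting at $\mu$ (`jackQ_eq_pathSum`),
and $\langle g_\kappa,P_\lambda\rangle=\sum f^\lambda(\delta)$ over filtrations from $\kappa$ to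
$\lambda$ (`form_gP_jackP_eq_sum`). Finally $J_\lambda=v_{\lambda\lambda}P_\lambda$, because
$P_\lambda$ has leading coefficient 1.

Both expansions come from one self-adjoint operator $D$ (`lap`) with $Dg_\lambda=e'_\lambda
g_\lambda+\sum_{\mu\in M^*(\lambda)}r_{\lambda\mu}g_\mu$ (`lap_gP`) and $DP_\lambda=e'_\lambda
P_\lambda$ (`lap_jackP`). Moving up strictly raises the dominance order, and $e'$ differs on
comparable partitions (`e'_ne`). The eigenvalue equation is therefore a recursion along the moves,
and unrolling it gives the sums over filtrations.

The operator $D$ is read off the Nazarov–Sklyanin Lax matrix. The vacuum entry of each power of that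
matrix is self-adjoint, and on the vectors $(g_{a-i}g_s)_i$ the matrix acts by a closed formula free
of power sums (`lax_hv`). The third power yields $D$.

The existence of the Jack functions has to be proved too, and $D$ alone does not give it: $e'$ takes
the same value on $(4,1,1)$ and $(3,3)$. A vacuum entry of a high power is triangular on the
$g_\lambda$ with diagonal entry $\alpha^j\sum_i\lambda_i^j$ plus lower degree in $\alpha$
(`vac_gP`), and for $j>n^2$ these values separate the partitions of $n$ (`eq_of_sum_pow_eq`). Its
eigenvectors are a Jack family (`exists_isJackFamily`). Conversely every self-adjoint triangular
operator, $D$ included, is diagonal on the Jack functions (`IsTri.apply_jackP`). -/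

/-- The power sum `p_k`, with `p_0 = 0`. -/
def psum (k : ℕ) : Sym := if 0 < k then X k.toPNat' else 0

/-- The derivation `α k ∂ / ∂ p_k`, adjoint to multiplication by `p_k`. -/
def skew (k : ℕ) : Derivation F Sym Sym :=
  if 0 < k then (α * (k : F)) • (pderiv k.toPNat' : Derivation F Sym Sym) else 0

/-- The functions `g_n`, given by the Newton recursion `α n g_n = ∑ p_k g_{n-k}`. -/
def g : ℕ → Sym
  | 0 => 1
  | n + 1 => (α * ((n + 1 : ℕ) : F))⁻¹ • ∑ k : Fin (n + 1), psum (k + 1) * g (n - k)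
  decreasing_by omega

/-- `g_n` for an integer `n`, zero when `n < 0`. -/
def gz : ℤ → Sym
  | Int.ofNat n => g n
  | Int.negSucc _ => 0

theorem α_ne_zero : α ≠ 0 := RatFunc.X_ne_zero

@[simp] theorem psum_zero : psum 0 = 0 := by simp [psum]

@[simp] theorem skew_zero : skew 0 = 0 := by simp [skew]

@[simp] theorem g_zero : g 0 = 1 := by rw [g]

@[simp] theorem gz_natCast (n : ℕ) : gz n = g n := rfl

theorem gz_of_neg {n : ℤ} (h : n < 0) : gz n = 0 := by
  obtain ⟨m, rfl⟩ := Int.eq_negSucc_of_lt_zero h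
  rfl

theorem g_newton (n : ℕ) :
    (α * ((n : ℕ) : F)) • g n = ∑ k ∈ Finset.range n, psum (k + 1) * g (n - 1 - k) := by
  cases n with
  | zero => simp
  | succ n =>
    rw [g, smul_smul, mul_inv_cancel₀ (mul_ne_zero α_ne_zero (Nat.cast_ne_zero.2 n.succ_ne_zero)),
      one_smul, Finset.sum_range]
    rfl

/-- The terms with `k = 0` and `k > n` vanish by convention, so the recursion holds for negative `n`
and for every sufficiently long range. Later sums then need no case distinctions at their ends. -/
theorem newton (M : ℕ) (n : ℤ) (h : n < M) :
    ∑ k ∈ Finset.range M, psum k * gz (n - k) = (α * (n : F)) • gz n := by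
  rcases lt_or_ge n 0 with hn | hn
  · rw [gz_of_neg hn, smul_zero]
    refine Finset.sum_eq_zero fun k _ => ?_
    rw [gz_of_neg (by omega), mul_zero]
  · lift n to ℕ using hn
    have hM : n + 1 ≤ M := by omega
    rw [← Finset.sum_subset (Finset.range_mono hM), Finset.sum_range_succ', psum_zero, zero_mul,
      add_zero, gz_natCast, Int.cast_natCast, g_newton]
    · refine Finset.sum_congr rfl fun k hk => ?_
      rw [Finset.mem_range] at hk
      rw [show (n : ℤ) - ((k + 1 : ℕ) : ℤ) = ((n - 1 - k : ℕ) : ℤ) by omega, gz_natCast]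
    · intro k _ hk
      rw [Finset.mem_range] at hk
      rw [gz_of_neg (by omega), mul_zero]

theorem coe_toPNat' {k : ℕ} (hk : 0 < k) : (k.toPNat' : ℕ) = k := by
  rw [Nat.toPNat'_coe, if_pos hk]

theorem skew_psum {k : ℕ} (hk : 0 < k) (j : ℕ) :
    skew k (psum j) = if j = k then C (α * (k : F)) else 0 := by
  rw [skew, if_pos hk, psum]
  split_ifs with h1 h2 h2
  · subst h2
    rw [Derivation.smul_apply, pderiv_X_self, smul_eq_C_mul, mul_one]
  · rw [Derivation.smul_apply, pderiv_X_of_ne, smul_zero]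
    intro h
    rw [← coe_toPNat' h1, h, coe_toPNat' hk] at h2
    exact h2 rfl
  · omega
  · simp

/-- On the generating function $\exp\sum_k p_kz^k/(\alpha k)$ the derivation $\alpha
k\,\partial/\partial p_k$ is multiplication by $z^k$. Formally, differentiating Newton's recursion
gives $\alpha(n-k)g_{n-k}+\alpha k\,g_{n-k}$ by induction. -/
theorem skew_gz {k : ℕ} (hk : 0 < k) (n : ℤ) : skew k (gz n) = gz (n - k) := by
  rcases lt_or_ge n 0 with hn | hn
  · rw [gz_of_neg hn, gz_of_neg (by omega), map_zero]
  lift n to ℕ using hn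
  induction n using Nat.strong_induction_on with
  | _ n ih =>
    rcases Nat.eq_zero_or_pos n with rfl | hn
    · rw [gz_natCast, g_zero, Derivation.map_one_eq_zero, gz_of_neg (by push_cast; omega)]
    -- The range `n + k + 1` contains the index `k` even when `k > n`, so the term where `skew k`
    -- meets `p_k` is always present.
    have h1 := congrArg (skew k) (newton (n + k + 1) n (by omega))
    rw [map_sum, Derivation.map_smul] at h1
    have h2 : ∀ j ∈ Finset.range (n + k + 1), skew k (psum j * gz ((n : ℤ) - j)) =
        psum j * gz ((n - k : ℤ) - j) +
          (if j = k then (α * (k : F)) • gz ((n : ℤ) - j) else 0) := by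
      intro j hj
      rw [Derivation.leibniz, skew_psum hk]
      congr 1
      · rcases Nat.eq_zero_or_pos j with rfl | hj0
        · simp
        rw [smul_eq_mul]
        congr 1
        rcases le_or_gt j n with hjn | hjn
        · have := ih (n - j) (by omega)
          rw [Nat.cast_sub hjn] at this
          rw [this]
          congr 1
          ring
        · rw [gz_of_neg (by omega), gz_of_neg (by omega), map_zero]
      · split_ifs
        · rw [smul_eq_mul, smul_eq_C_mul, mul_comm]
        · rw [smul_zero]
    rw [Finset.sum_congr rfl h2, Finset.sum_add_distrib, newton _ _ (by push_cast; omega),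
      Finset.sum_ite_eq' , if_pos (Finset.mem_range.2 (by omega)), ← add_smul] at h1
    have h3 : α * (((n - k : ℤ)) : F) + α * (k : F) = α * ((n : ℤ) : F) := by
      push_cast; ring
    rw [h3] at h1
    exact (smul_right_injective Sym (mul_ne_zero α_ne_zero
      (by exact_mod_cast hn.ne'))) h1.symm

/-! ### The scalar product -/

theorem normSq_ne_zero (d : ℕ+ →₀ ℕ) : normSq d ≠ 0 := by
  rw [normSq]
  refine mul_ne_zero (pow_ne_zero _ α_ne_zero) (Finset.prod_ne_zero_iff.2 fun i _ => ?_)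
  exact mul_ne_zero (pow_ne_zero _ (Nat.cast_ne_zero.2 i.ne_zero))
    (Nat.cast_ne_zero.2 (Nat.factorial_ne_zero _))

theorem inner_comm (f h : Sym) : inner f h = inner h f := by
  have key : ∀ a b : Sym, inner a b =
      ∑ d ∈ a.support ∪ b.support, coeff d a * coeff d b * normSq d := by
    intro a b
    refine Finset.sum_subset Finset.subset_union_left fun d _ hd => ?_
    rw [notMem_support_iff.1 hd, zero_mul, zero_mul]
  rw [key, key, Finset.union_comm]
  exact Finset.sum_congr rfl fun d _ => by rw [mul_comm (coeff d f)]

theorem inner_add_right (f h k : Sym) : inner f (h + k) = inner f h + inner f k := by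
  simp only [inner, coeff_add, mul_add, add_mul, Finset.sum_add_distrib]

theorem inner_smul_right (c : F) (f h : Sym) : inner f (c • h) = c * inner f h := by
  simp only [inner, coeff_smul, Finset.mul_sum, smul_eq_mul]
  exact Finset.sum_congr rfl fun d _ => by ring

/-- The scalar product as a bilinear form. -/
def form : LinearMap.BilinForm F Sym :=
  LinearMap.mk₂ F inner
    (fun a b c => by rw [inner_comm, inner_add_right, inner_comm c, inner_comm c])
    (fun a b c => by rw [inner_comm, inner_smul_right, inner_comm c, smul_eq_mul])
    inner_add_right (fun c a b => inner_smul_right c a b)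

theorem form_apply (f h : Sym) : form f h = inner f h := rfl

theorem form_comm (f h : Sym) : form f h = form h f := inner_comm f h

theorem form_monomial_right (f : Sym) (d : ℕ+ →₀ ℕ) :
    form f (monomial d 1) = coeff d f * normSq d := by
  rw [form_comm, form_apply, inner, support_monomial, if_neg one_ne_zero, Finset.sum_singleton,
    coeff_monomial, if_pos rfl, one_mul]

theorem eq_zero_of_form_eq_zero {f : Sym} (h : ∀ k, form f k = 0) : f = 0 := by
  ext d
  have := h (monomial d 1)
  rw [form_monomial_right] at this
  rw [coeff_zero]
  exact (mul_eq_zero.1 this).resolve_right (normSq_ne_zero d)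

theorem normSq_add_single (d : ℕ+ →₀ ℕ) (k : ℕ+) :
    normSq (d + Finsupp.single k 1) = α * (k : ℕ) * ((d k + 1 : ℕ) : F) * normSq d := by
  have hs : ∀ e : ℕ+ →₀ ℕ, e.support ⊆ insert k d.support →
      normSq e = α ^ (∑ i ∈ insert k d.support, e i) *
        ∏ i ∈ insert k d.support, (((i : ℕ) : F) ^ e i * (Nat.factorial (e i) : F)) := by
    intro e he
    rw [normSq, Finsupp.sum_of_support_subset _ he _ (by simp),
      Finsupp.prod_of_support_subset _ he _ (by simp)]
  rw [hs d (Finset.subset_insert _ _), hs (d + Finsupp.single k 1)]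
  · have hk : k ∈ insert k d.support := Finset.mem_insert_self _ _
    rw [← Finset.add_sum_erase _ _ hk, ← Finset.add_sum_erase _ (fun i => d i) hk,
      ← Finset.mul_prod_erase _ _ hk,
      ← Finset.mul_prod_erase _ (fun i : ℕ+ => ((i : ℕ) : F) ^ d i * (Nat.factorial (d i) : F)) hk]
    have hne : ∀ i ∈ (insert k d.support).erase k,
        (d + Finsupp.single k 1 : ℕ+ →₀ ℕ) i = d i := by
      intro i hi
      rw [Finsupp.add_apply, Finsupp.single_eq_of_ne (Finset.ne_of_mem_erase hi), add_zero]
    rw [Finset.sum_congr rfl hne, Finset.prod_congr rfl fun i hi => by rw [hne i hi]]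
    rw [Finsupp.add_apply, Finsupp.single_eq_same, Nat.factorial_succ]
    push_cast
    ring
  · refine (Finsupp.support_add).trans (Finset.union_subset (Finset.subset_insert _ _) ?_)
    exact Finsupp.support_single_subset.trans (by simp)

/-- On monomials the claim is that the norm ratio $\alpha k(d_k+1)$ of `normSq_add_single` equals
the factor produced by $\alpha k\,\partial/\partial p_k$. -/
theorem form_psum_mul (k : ℕ) (f h : Sym) : form (psum k * f) h = form f (skew k h) := by
  rcases Nat.eq_zero_or_pos k with rfl | hk
  · simp
  have : form.comp (LinearMap.mulLeft F (psum k)) LinearMap.id =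
      form.comp LinearMap.id (skew k : Sym →ₗ[F] Sym) := by
    refine (basisMonomials ℕ+ F).ext fun d => (basisMonomials ℕ+ F).ext fun e => ?_
    rw [coe_basisMonomials]
    simp only [LinearMap.BilinForm.comp_apply, LinearMap.id_apply,
      LinearMap.mulLeft_apply, Derivation.coeFn_coe]
    rw [skew, if_pos hk, psum, if_pos hk, Derivation.smul_apply, pderiv_monomial, one_mul, X,
      monomial_mul, one_mul, map_smul, form_monomial_right, coeff_monomial]
    have h2 : monomial (e - Finsupp.single k.toPNat' 1) ((e k.toPNat' : ℕ) : F) =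
        ((e k.toPNat' : ℕ) : F) • monomial (e - Finsupp.single k.toPNat' 1) 1 := by
      rw [smul_monomial, smul_eq_mul, mul_one]
    rw [h2, map_smul, form_monomial_right, coeff_monomial]
    by_cases he : e k.toPNat' = 0
    · rw [if_neg, he]
      · simp
      · rintro rfl
        simp at he
    · have hle : Finsupp.single (k.toPNat' : ℕ+) 1 ≤ e := by
        rw [Finsupp.single_le_iff]; omega
      obtain ⟨e', rfl⟩ := exists_add_of_le hle
      rw [add_tsub_cancel_left, add_comm (Finsupp.single _ 1) e', normSq_add_single, coe_toPNat' hk]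
      by_cases hd : d = e'
      · subst hd
        rw [if_pos (add_comm _ _), if_pos rfl]
        simp
        ring
      · rw [if_neg hd, if_neg (by rwa [add_comm (Finsupp.single _ 1) d, add_left_inj])]
        simp
  exact LinearMap.congr_fun (LinearMap.congr_fun this f) h

/-! ### Products of the `g_n` -/

/-- The product of the `g_b`, for `b` in a multiset. -/
def gM (s : Multiset ℕ) : Sym := (s.map g).prod

@[simp] theorem gM_zero : gM 0 = 1 := by simp [gM]

@[simp] theorem gM_cons (a : ℕ) (s : Multiset ℕ) : gM (a ::ₘ s) = g a * gM s := by simp [gM]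

theorem gM_add (s t : Multiset ℕ) : gM (s + t) = gM s * gM t := by simp [gM]

theorem gM_filter (s : Multiset ℕ) : gM (s.filter (0 < ·)) = gM s := by
  induction s using Multiset.induction_on with
  | empty => simp
  | cons a s ih =>
    rcases Nat.eq_zero_or_pos a with rfl | h
    · rw [Multiset.filter_cons_of_neg (p := (0 < ·)) _ (lt_irrefl 0), ih, gM_cons, g_zero, one_mul]
    · rw [Multiset.filter_cons_of_pos (p := (0 < ·)) _ h, gM_cons, gM_cons, ih]

theorem skew_gM {k : ℕ} (hk : 0 < k) (s : Multiset ℕ) :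
    skew k (gM s) = (s.map fun b : ℕ => gz ((b : ℤ) - k) * gM (s.erase b)).sum := by
  induction s using Multiset.induction_on with
  | empty => simp
  | cons a s ih =>
    rw [gM_cons, Derivation.leibniz, ih, Multiset.map_cons, Multiset.sum_cons,
      Multiset.erase_cons_head, ← gz_natCast, skew_gz hk, add_comm, smul_eq_mul, mul_comm,
      smul_eq_mul, ← Multiset.sum_map_mul_left]
    congr 2
    refine Multiset.map_congr rfl fun b hb => ?_
    by_cases hba : b = a
    · subst hba
      rw [Multiset.erase_cons_head, ← Multiset.cons_erase hb, gM_cons, Multiset.erase_cons_head,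
        gz_natCast]
      ring
    · rw [Multiset.erase_cons_tail _ (Ne.symm hba), gM_cons, gz_natCast]
      ring

/-! ### Weights -/

/-- The symmetric functions that are homogeneous of degree `n`. -/
def homog (n : ℕ) : Submodule F Sym := weightedHomogeneousSubmodule F (fun k : ℕ+ => (k : ℕ)) n

theorem homog_mul {m n : ℕ} {f h : Sym} (hf : f ∈ homog m) (hh : h ∈ homog n) :
    f * h ∈ homog (m + n) :=
  IsWeightedHomogeneous.mul hf hh

theorem one_mem_homog : (1 : Sym) ∈ homog 0 := isWeightedHomogeneous_one F _

theorem psum_mem_homog (k : ℕ) : psum k ∈ homog k := by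
  rw [psum]
  split_ifs with h
  · have := isWeightedHomogeneous_X F (fun k : ℕ+ => (k : ℕ)) k.toPNat'
    rwa [coe_toPNat' h] at this
  · exact zero_mem _

theorem g_mem_homog (n : ℕ) : g n ∈ homog n := by
  induction n using Nat.strong_induction_on with
  | _ n ih =>
    rcases Nat.eq_zero_or_pos n with rfl | hn
    · rw [g_zero]
      exact one_mem_homog
    · rw [← inv_smul_smul₀ (mul_ne_zero α_ne_zero (Nat.cast_ne_zero.2 hn.ne')) (g n), g_newton]
      refine Submodule.smul_mem _ _ (Submodule.sum_mem _ fun k hk => ?_)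
      rw [Finset.mem_range] at hk
      have := homog_mul (psum_mem_homog (k + 1)) (ih (n - 1 - k) (by omega))
      rwa [show k + 1 + (n - 1 - k) = n by omega] at this

theorem gM_mem_homog (s : Multiset ℕ) : gM s ∈ homog s.sum := by
  induction s using Multiset.induction_on with
  | empty => simpa using one_mem_homog
  | cons a s ih =>
    rw [gM_cons, Multiset.sum_cons]
    exact homog_mul (g_mem_homog a) ih

theorem form_eq_zero_of_homog {m n : ℕ} (hmn : m ≠ n) {f h : Sym} (hf : f ∈ homog m)
    (hh : h ∈ homog n) : form f h = 0 := by
  refine Finset.sum_eq_zero fun d hd => ?_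
  have h1 := hf (mem_support_iff.1 hd)
  have h2 : coeff d h = 0 := hh.coeff_eq_zero d (by rw [h1]; exact hmn)
  rw [h2, mul_zero, zero_mul]

/-! ### The dual of the `g_λ` -/

theorem psumSeries_mul_coeff {k : ℕ} (hk : 0 < k) (e : ℕ →₀ ℕ) (S : MvPowerSeries ℕ F) :
    MvPowerSeries.coeff e (psumSeries k.toPNat' * S) =
      ∑ i ∈ e.support.filter (fun i => k ≤ e i),
        MvPowerSeries.coeff (e - Finsupp.single i k) S := by
  rw [MvPowerSeries.coeff_mul]
  have hc : ∀ u : ℕ →₀ ℕ, MvPowerSeries.coeff u (psumSeries k.toPNat') =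
      if ∃ i : ℕ, u = Finsupp.single i k then 1 else 0 := by
    intro u
    change (if ∃ i : ℕ, u = Finsupp.single i (k.toPNat' : ℕ) then (1 : F) else 0) = _
    rw [coe_toPNat' hk]
  have hinj : Set.InjOn (fun i => (Finsupp.single i k, e - Finsupp.single i k))
      (e.support.filter (fun i => k ≤ e i)) := by
    intro i _ j _ hij
    exact (Finsupp.single_left_inj hk.ne').1 (congrArg Prod.fst hij)
  symm
  rw [← Finset.sum_subset (s₁ := (e.support.filter (fun i => k ≤ e i)).image
    fun i => (Finsupp.single i k, e - Finsupp.single i k)), Finset.sum_image hinj]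
  · refine Finset.sum_congr rfl fun i _ => ?_
    rw [hc, if_pos ⟨i, rfl⟩, one_mul]
  · intro x hx
    obtain ⟨i, hi, rfl⟩ := Finset.mem_image.1 hx
    rw [Finset.HasAntidiagonal.mem_antidiagonal]
    exact add_tsub_cancel_of_le (Finsupp.single_le_iff.2 (Finset.mem_filter.1 hi).2)
  · rintro ⟨u, w⟩ hx hx'
    rw [hc, if_neg, zero_mul]
    rintro ⟨i, rfl⟩
    rw [Finset.HasAntidiagonal.mem_antidiagonal] at hx
    refine hx' (Finset.mem_image.2 ⟨i, ?_, ?_⟩)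
    · rw [Finset.mem_filter, Finsupp.mem_support_iff, ← hx]
      simp
      omega
    · rw [← hx]
      simp

/-- The product of the `g_{e i}`. -/
def gE (e : ℕ →₀ ℕ) : Sym := gM (e.support.val.map e)

theorem gE_eq {e : ℕ →₀ ℕ} {s : Finset ℕ} (h : e.support ⊆ s) : gE e = ∏ i ∈ s, g (e i) := by
  rw [gE, gM, Multiset.map_map, ← Finset.prod_subset h]
  · rfl
  · intro i _ hi
    rw [Finsupp.notMem_support_iff.1 hi, g_zero]

theorem skew_gE {k : ℕ} (hk : 0 < k) (e : ℕ →₀ ℕ) :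
    skew k (gE e) =
      ∑ i ∈ e.support.filter (fun i => k ≤ e i), gE (e - Finsupp.single i k) := by
  rw [gE, skew_gM hk, Multiset.map_map, Finset.sum_filter]
  refine congrArg Multiset.sum (Multiset.map_congr rfl fun i hi => ?_)
  rw [Function.comp_apply]
  split_ifs with h
  · rw [gE_eq (s := e.support) (Finsupp.support_mono tsub_le_self),
      ← Finset.mul_prod_erase _ _ (Finset.mem_def.2 hi), Finsupp.tsub_apply,
      Finsupp.single_eq_same, ← Nat.cast_sub h, gz_natCast, ← Multiset.map_erase_of_mem _ _ hi,
      gM, Multiset.map_map]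
    congr 1
    rw [← Finset.erase_val]
    refine Finset.prod_congr rfl fun j hj => ?_
    rw [Finsupp.tsub_apply, Finsupp.single_eq_of_ne (Finset.ne_of_mem_erase hj)]
    rfl
  · rw [gz_of_neg (by omega), zero_mul]

/-- Induction on `f` through multiplication by $p_k$. In the series $p_k$ lowers one exponent by `k`
in all possible ways, and the adjoint `skew k` does the same to the indices in the product of the
`g`. -/
theorem coeff_toSeries (e : ℕ →₀ ℕ) (f : Sym) :
    MvPowerSeries.coeff e (toSeries f) = form (gE e) f := by
  induction f using MvPolynomial.induction_on generalizing e with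
  | C a =>
    rw [toSeries, aeval_C, MvPowerSeries.algebraMap_apply, Algebra.algebraMap_self,
      RingHom.id_apply, MvPowerSeries.coeff_C]
    have : (C a : Sym) = a • monomial 0 1 := by
      rw [smul_monomial, smul_eq_mul, mul_one]; rfl
    rw [this, map_smul, form_monomial_right]
    split_ifs with h
    · subst h
      simp [gE, normSq]
    · rw [gE, (gM_mem_homog _).coeff_eq_zero, zero_mul, smul_zero]
      rw [map_zero]
      intro hs
      obtain ⟨i, hi⟩ := Finsupp.support_nonempty_iff.2 h
      refine Finsupp.mem_support_iff.1 hi (Multiset.sum_eq_zero_iff.1 hs.symm _ ?_)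
      exact Multiset.mem_map_of_mem _ hi
  | add p q hp hq => rw [map_add, map_add, map_add, hp, hq]
  | mul_X p k hp =>
    have hX : (X k : Sym) = psum k := by rw [psum, if_pos k.pos, PNat.coe_toPNat']
    rw [mul_comm, map_mul, toSeries, aeval_X, hX, form_comm, form_psum_mul, form_comm,
      skew_gE k.pos, map_sum, LinearMap.sum_apply]
    conv_lhs => rw [← PNat.coe_toPNat' k]
    rw [psumSeries_mul_coeff k.pos]
    exact Finset.sum_congr rfl fun i _ => hp _

/-- `g_λ`, the product of the `g_{λ_i}`. -/
def gP (l : Ptn) : Sym := gM l.parts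

theorem mCoeff_eq (l : Ptn) (f : Sym) : mCoeff l f = form (gP l) f := by
  rw [mCoeff, coeff_toSeries, gP]
  congr 2
  have h1 : gE l.rows.toFinsupp = gM l.rows := by
    rw [gE_eq (s := Finset.range l.rows.length), gM, Multiset.map_coe, Multiset.prod_coe,
      Finset.prod_range]
    · simp only [List.toFinsupp_apply, List.getD_eq_getElem?_getD]
      rw [← List.prod_ofFn]
      congr 1
      refine List.ext_getElem (by simp) fun i h1 h2 => ?_
      simp
    · intro i hi
      rw [Finsupp.mem_support_iff, List.toFinsupp_apply] at hi
      rw [Finset.mem_range]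
      by_contra h
      exact hi (List.getD_eq_default _ _ (not_lt.1 h))
  rw [h1, Ptn.rows, Multiset.sort_eq]

theorem gP_mem_homog (l : Ptn) : gP l ∈ homog l.weight := gM_mem_homog _

/-! ### The basis of the `g_λ` and its dual -/

/-- Partitions as exponents of monomials in the power sums. -/
def ptnEquiv : (ℕ+ →₀ ℕ) ≃ Ptn where
  toFun d := ⟨(Finsupp.toMultiset d).map PNat.val, fun i hi => by
    obtain ⟨k, -, rfl⟩ := Multiset.mem_map.1 hi
    exact k.pos⟩
  invFun l := Multiset.toFinsupp (l.parts.map Nat.toPNat')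
  left_inv d := by
    simp only [Multiset.map_map]
    rw [Multiset.map_congr (g := id) rfl fun k _ => by simp, Multiset.map_id,
      Finsupp.toMultiset_toFinsupp]
  right_inv l := by
    ext1
    simp only [Multiset.toFinsupp_toMultiset, Multiset.map_map]
    exact (Multiset.map_congr (g := id) rfl fun k hk => coe_toPNat' (l.pos k hk)).trans
      (Multiset.map_id _)

/-- The polynomials in `h_1, h_2, …` expressing the power sum `p_n` through `h_k = g_k`. -/
def psumInG : ℕ → Sym
  | 0 => 0
  | n + 1 => (α * ((n + 1 : ℕ) : F)) • psum (n + 1) -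
      ∑ k : Fin n, psumInG (k + 1) * psum (n - k)

theorem psumInG_eq {n : ℕ} (hn : 0 < n) :
    psumInG n + ∑ k ∈ Finset.range (n - 1), psumInG (k + 1) * psum (n - 1 - k) =
      (α * (n : F)) • psum n := by
  obtain ⟨m, rfl⟩ : ∃ m, n = m + 1 := ⟨n - 1, by omega⟩
  rw [psumInG, Finset.sum_range]
  simp

/-- The substitution `p_k ↦ g_k`. -/
def gHom : Sym →ₐ[F] Sym := aeval fun k : ℕ+ => g k

/-- The inverse of the substitution `p_k ↦ g_k`. -/
def gInv : Sym →ₐ[F] Sym := aeval fun k : ℕ+ => psumInG k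

theorem gHom_psum {k : ℕ} (hk : 0 < k) : gHom (psum k) = g k := by
  rw [psum, if_pos hk, gHom, aeval_X, coe_toPNat' hk]

theorem gInv_psum (k : ℕ) : gInv (psum k) = psumInG k := by
  rcases Nat.eq_zero_or_pos k with rfl | hk
  · simp [psumInG]
  · rw [psum, if_pos hk, gInv, aeval_X, coe_toPNat' hk]

theorem g_newton' {n : ℕ} (hn : 0 < n) :
    psum n + ∑ k ∈ Finset.range (n - 1), psum (k + 1) * g (n - 1 - k) = (α * (n : F)) • g n := by
  obtain ⟨m, rfl⟩ : ∃ m, n = m + 1 := ⟨n - 1, by omega⟩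
  rw [g_newton, Finset.sum_range_succ]
  simp [add_comm]

/-- `psumInG` obeys Newton's recursion with the roles of the $p_k$ and the $g_k$ exchanged, so the
two substitutions undo each other by strong induction. This gives the algebraic independence of the
$g_k$. -/
theorem gInv_g {n : ℕ} (hn : 0 < n) : gInv (g n) = psum n := by
  induction n using Nat.strong_induction_on with
  | _ n ih =>
    have h := congrArg gInv (g_newton' hn)
    rw [map_add, map_sum, map_smul, gInv_psum] at h
    rw [Finset.sum_congr rfl fun k hk => by
      rw [map_mul, gInv_psum, ih (n - 1 - k) (by omega) (by
        rw [Finset.mem_range] at hk; omega)], psumInG_eq hn] at h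
    exact (smul_right_injective Sym (mul_ne_zero α_ne_zero (Nat.cast_ne_zero.2 hn.ne'))) h.symm

theorem gHom_psumInG (n : ℕ) : gHom (psumInG n) = psum n := by
  induction n using Nat.strong_induction_on with
  | _ n ih =>
    rcases Nat.eq_zero_or_pos n with rfl | hn
    · simp [psumInG]
    have h := congrArg gHom (psumInG_eq hn)
    rw [map_add, map_sum, map_smul, gHom_psum hn, ← g_newton' hn] at h
    have hs : ∀ k ∈ Finset.range (n - 1), gHom (psumInG (k + 1) * psum (n - 1 - k)) =
        psum (k + 1) * g (n - 1 - k) := by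
      intro k hk
      rw [Finset.mem_range] at hk
      rw [map_mul, gHom_psum (by omega), ih (k + 1) (by omega)]
    rw [Finset.sum_congr rfl hs] at h
    exact add_right_cancel h

/-- The substitution `p_k ↦ g_k` as an automorphism. -/
def gEquiv : Sym ≃ₐ[F] Sym :=
  AlgEquiv.ofAlgHom gHom gInv
    (by
      refine MvPolynomial.algHom_ext fun k => ?_
      rw [AlgHom.comp_apply, gInv, aeval_X, gHom_psumInG, psum, if_pos k.pos, PNat.coe_toPNat',
        AlgHom.id_apply])
    (by
      refine MvPolynomial.algHom_ext fun k => ?_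
      rw [AlgHom.comp_apply, gHom, aeval_X, gInv_g k.pos, psum, if_pos k.pos, PNat.coe_toPNat',
        AlgHom.id_apply])

/-- The basis of the `g_λ`. -/
def gB : Module.Basis Ptn F Sym :=
  ((basisMonomials ℕ+ F).map gEquiv.toLinearEquiv).reindex ptnEquiv

theorem gB_apply (l : Ptn) : gB l = gP l := by
  obtain ⟨d, rfl⟩ := ptnEquiv.surjective l
  rw [gB, Module.Basis.reindex_apply, Equiv.symm_apply_apply, Module.Basis.map_apply,
    coe_basisMonomials]
  change gHom (monomial d 1) = _
  rw [gHom, aeval_monomial, map_one, one_mul, gP, gM]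
  change _ = (((Finsupp.toMultiset d).map PNat.val).map g).prod
  rw [Multiset.map_map, Finsupp.toMultiset_map, Finsupp.prod_toMultiset,
    Finsupp.prod_mapDomain_index (by simp) (by intros; rw [pow_add])]
  rfl

theorem gB_repr (f : Sym) (d : ℕ+ →₀ ℕ) : gB.repr f (ptnEquiv d) = coeff d (gInv f) := by
  rw [gB, Module.Basis.repr_reindex_apply, Equiv.symm_apply_apply, Module.Basis.map_repr]
  rfl

theorem weight_ptnEquiv (d : ℕ+ →₀ ℕ) :
    (ptnEquiv d).weight = Finsupp.weight (fun k : ℕ+ => (k : ℕ)) d := by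
  change ((Finsupp.toMultiset d).map PNat.val).sum = _
  rw [Finsupp.toMultiset_map, Finsupp.sum_toMultiset, Finsupp.weight_apply,
    Finsupp.sum_mapDomain_index (by simp) (by intros; rw [add_smul])]

theorem psumInG_mem_homog (n : ℕ) : psumInG n ∈ homog n := by
  induction n using Nat.strong_induction_on with
  | _ n ih =>
    rcases Nat.eq_zero_or_pos n with rfl | hn
    · rw [psumInG]
      exact zero_mem _
    · rw [eq_sub_of_add_eq (psumInG_eq hn)]
      refine sub_mem (Submodule.smul_mem _ _ (psum_mem_homog n)) (Submodule.sum_mem _ fun k hk => ?_)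
      rw [Finset.mem_range] at hk
      have := homog_mul (ih (k + 1) (by omega)) (psum_mem_homog (n - 1 - k))
      rwa [show k + 1 + (n - 1 - k) = n by omega] at this

theorem gInv_mem_homog {n : ℕ} {f : Sym} (hf : f ∈ homog n) : gInv f ∈ homog n := by
  rw [f.as_sum, map_sum]
  refine Submodule.sum_mem _ fun d hd => ?_
  rw [gInv, aeval_monomial, ← Algebra.smul_def]
  refine Submodule.smul_mem _ _ ?_
  have hw : Finsupp.weight (fun k : ℕ+ => (k : ℕ)) d = n := hf (mem_support_iff.1 hd)
  rw [← hw, Finsupp.weight_apply]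
  exact IsWeightedHomogeneous.prod _ _ _ fun k _ => (psumInG_mem_homog k).pow (d k)

theorem gB_repr_eq_zero {n : ℕ} {f : Sym} (hf : f ∈ homog n) {l : Ptn} (hl : l.weight ≠ n) :
    gB.repr f l = 0 := by
  obtain ⟨d, rfl⟩ := ptnEquiv.surjective l
  rw [gB_repr]
  exact (gInv_mem_homog hf).coeff_eq_zero d (by rwa [← weight_ptnEquiv])

/-- The partitions of `n`. -/
def ptns (n : ℕ) : Finset Ptn :=
  (Finset.univ : Finset (Nat.Partition n)).image fun p => ⟨p.parts, fun _ hi => p.parts_pos hi⟩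

theorem mem_ptns {n : ℕ} {l : Ptn} : l ∈ ptns n ↔ l.weight = n := by
  rw [ptns, Finset.mem_image]
  constructor
  · rintro ⟨p, -, rfl⟩
    exact p.parts_sum
  · intro h
    exact ⟨⟨l.parts, fun {i} hi => l.pos i hi, h⟩, Finset.mem_univ _, rfl⟩

/-- The symmetric function `m_λ`. -/
def mP (l : Ptn) : Sym :=
  -- The vector representing the coordinate functional of $g_\lambda$, written in the orthogonal
  -- basis of power-sum monomials; only those of degree $|\lambda|$ contribute.
  ∑ k ∈ ptns l.weight, (gB.repr (monomial (ptnEquiv.symm k) 1) l / normSq (ptnEquiv.symm k)) •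
    monomial (ptnEquiv.symm k) 1

theorem monomial_mem_homog (d : ℕ+ →₀ ℕ) :
    (monomial d 1 : Sym) ∈ homog (ptnEquiv d).weight :=
  isWeightedHomogeneous_monomial _ d 1 (weight_ptnEquiv d).symm

theorem mP_mem_homog (l : Ptn) : mP l ∈ homog l.weight := by
  refine Submodule.sum_mem _ fun k hk => Submodule.smul_mem _ _ ?_
  have := monomial_mem_homog (ptnEquiv.symm k)
  rwa [Equiv.apply_symm_apply, mem_ptns.1 hk] at this

theorem form_mP (f : Sym) (l : Ptn) : form f (mP l) = gB.repr f l := by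
  have : form.flip (mP l) = gB.coord l := by
    refine (basisMonomials ℕ+ F).ext fun d => ?_
    rw [coe_basisMonomials, Module.Basis.coord_apply]
    change form (monomial d 1) (mP l) = _
    by_cases hd : (ptnEquiv d).weight = l.weight
    · rw [mP, map_sum, Finset.sum_eq_single (ptnEquiv d)]
      · rw [Equiv.symm_apply_apply, map_smul, form_monomial_right, coeff_monomial, if_pos rfl,
          one_mul, smul_eq_mul, div_mul_cancel₀ _ (normSq_ne_zero d)]
      · intro k _ hk
        rw [map_smul, form_monomial_right, coeff_monomial, if_neg, zero_mul, smul_zero]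
        rintro rfl
        rw [Equiv.apply_symm_apply] at hk
        exact hk rfl
      · intro h
        exact absurd (mem_ptns.2 hd) h
    · rw [gB_repr_eq_zero (monomial_mem_homog d) (Ne.symm hd),
        form_eq_zero_of_homog hd (monomial_mem_homog d) (mP_mem_homog l)]
  exact LinearMap.congr_fun this f

theorem form_gP_mP (k l : Ptn) : form (gP k) (mP l) = if k = l then 1 else 0 := by
  rw [form_mP, ← gB_apply, Module.Basis.repr_self, Finsupp.single_apply]

theorem toSeries_mP (l : Ptn) : toSeries (mP l) = monomialSeries l := by
  ext e
  rw [coeff_toSeries]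
  change _ = if e.support.val.map (fun i => e i) = l.parts then (1 : F) else 0
  have hpos : ∀ i ∈ e.support.val.map (fun i => e i), 0 < i := by
    intro i hi
    obtain ⟨j, hj, rfl⟩ := Multiset.mem_map.1 hi
    exact Nat.pos_of_ne_zero (Finsupp.mem_support_iff.1 hj)
  have : gE e = gP ⟨e.support.val.map (fun i => e i), hpos⟩ := rfl
  rw [this, form_gP_mP]
  exact if_congr Ptn.ext_iff rfl rfl

theorem eq_of_form_mP {f h : Sym} (H : ∀ l, form f (mP l) = form h (mP l)) : f = h :=
  gB.ext_elem fun l => by rw [← form_mP, ← form_mP, H]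

theorem eq_of_form_gP {f h : Sym} (H : ∀ l, form (gP l) f = form (gP l) h) : f = h := by
  rw [← sub_eq_zero]
  refine eq_zero_of_form_eq_zero fun k => ?_
  have : form (f - h) = 0 := gB.ext fun l => by
    rw [gB_apply, form_comm, map_sub, H, sub_self, LinearMap.zero_apply]
  rw [this, LinearMap.zero_apply]

theorem toSeries_injective : Function.Injective toSeries := by
  intro f h hfh
  refine eq_of_form_gP fun l => ?_
  rw [← mCoeff_eq, ← mCoeff_eq, mCoeff, mCoeff, hfh]

theorem eq_sum_mP {n : ℕ} {f : Sym} (hf : f ∈ homog n) :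
    f = ∑ l ∈ ptns n, form (gP l) f • mP l := by
  refine eq_of_form_gP fun k => ?_
  rw [map_sum]
  simp only [map_smul, form_gP_mP, smul_eq_mul, mul_ite, mul_one, mul_zero]
  rw [Finset.sum_ite_eq]
  split_ifs with h
  · rfl
  · exact form_eq_zero_of_homog (fun h' => h (mem_ptns.2 h')) (gP_mem_homog k) hf

theorem eq_sum_gP {n : ℕ} {f : Sym} (hf : f ∈ homog n) :
    f = ∑ l ∈ ptns n, gB.repr f l • gP l := by
  refine eq_of_form_mP fun k => ?_
  rw [map_sum, LinearMap.sum_apply]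
  simp only [map_smul, LinearMap.smul_apply, form_gP_mP, smul_eq_mul, mul_ite, mul_one, mul_zero]
  rw [Finset.sum_ite_eq', form_mP]
  split_ifs with h
  · rfl
  · exact gB_repr_eq_zero hf fun h' => h (mem_ptns.2 h')

/-! ### The Lax operator -/

/-- The entries of the (Nazarov–Sklyanin) Lax matrix: multiplication by `p_{j - i}` above the
diagonal, the adjoint of `p_{i - j}` below it, and the scalar `(α - 1) i` on it. -/
def laxEntry (i j : ℕ) : Sym →ₗ[F] Sym :=
  -- Truncated subtraction together with `psum 0 = 0` and `skew 0 = 0` makes each of the first two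
  -- summands vanish off its own side of the diagonal.
  LinearMap.mulLeft F (psum (j - i)) + (skew (i - j) : Sym →ₗ[F] Sym) +
    (if i = j then ((α - 1) * (i : F)) • LinearMap.id else 0)

theorem laxEntry_apply (i j : ℕ) (f : Sym) :
    laxEntry i j f = psum (j - i) * f + skew (i - j) f +
      (if i = j then ((α - 1) * (i : F)) • f else 0) := by
  rw [laxEntry]
  split_ifs <;> rfl

theorem form_laxEntry (i j : ℕ) (f h : Sym) :
    form (laxEntry i j f) h = form f (laxEntry j i h) := by
  rw [laxEntry_apply, laxEntry_apply, map_add, map_add, LinearMap.add_apply, LinearMap.add_apply,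
    map_add, map_add, form_psum_mul, form_comm f (psum (i - j) * h), form_psum_mul,
    form_comm h, add_comm (form f (skew (j - i) h))]
  congr 1
  by_cases hij : i = j
  · subst hij
    simp
  · rw [if_neg hij, if_neg (Ne.symm hij)]
    simp

/-- The Lax operator, truncated to the first `N + 1` coordinates of the source. -/
def lax (N : ℕ) : (ℕ → Sym) →ₗ[F] (ℕ → Sym) :=
  LinearMap.pi fun i => ∑ j ∈ Finset.range (N + 1), (laxEntry i j).comp (LinearMap.proj j)

theorem lax_apply (N : ℕ) (f : ℕ → Sym) (i : ℕ) :
    lax N f i = ∑ j ∈ Finset.range (N + 1), laxEntry i j (f j) := by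
  simp [lax]

/-- Transposed entries of the block `i, j ≤ N` are adjoint to each other. Output coordinates beyond
`N` are never read again. -/
theorem sum_form_lax (N : ℕ) (f h : ℕ → Sym) :
    ∑ i ∈ Finset.range (N + 1), form (lax N f i) (h i) =
      ∑ i ∈ Finset.range (N + 1), form (f i) (lax N h i) := by
  simp only [lax_apply, map_sum, LinearMap.sum_apply]
  rw [Finset.sum_comm]
  simp only [form_laxEntry]

theorem sum_form_lax_pow (N k : ℕ) (f h : ℕ → Sym) :
    ∑ i ∈ Finset.range (N + 1), form ((lax N ^ k) f i) (h i) =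
      ∑ i ∈ Finset.range (N + 1), form (f i) ((lax N ^ k) h i) := by
  induction k generalizing f h with
  | zero => simp
  | succ k ih => rw [pow_succ', Module.End.mul_apply, sum_form_lax, ih, ← Module.End.mul_apply,
      ← pow_succ, ← pow_succ']

/-- The vacuum entry of the powers of the Lax matrix. -/
def vac (N k : ℕ) : Sym →ₗ[F] Sym :=
  (LinearMap.proj 0).comp ((lax N ^ k).comp (LinearMap.single F (fun _ => Sym) 0))

theorem vac_apply (N k : ℕ) (f : Sym) : vac N k f = (lax N ^ k) (Pi.single 0 f) 0 := rfl

theorem form_vac (N k : ℕ) (f h : Sym) : form (vac N k f) h = form f (vac N k h) := by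
  have := sum_form_lax_pow N k (Pi.single 0 f) (Pi.single 0 h)
  rw [Finset.sum_eq_single 0, Finset.sum_eq_single 0, Pi.single_eq_same, Pi.single_eq_same] at this
  · exact this
  all_goals simp +contextual

/-- The vector with coordinates `g_{a - i} g_s`. -/
def hv (a : ℕ) (s : Multiset ℕ) : ℕ → Sym := fun i => gz ((a : ℤ) - i) * gM s

theorem hv_apply_zero (a : ℕ) (s : Multiset ℕ) : hv a s 0 = gM (a ::ₘ s) := by
  rw [hv, Nat.cast_zero, sub_zero, gz_natCast, gM_cons]

theorem hv_zero (s : Multiset ℕ) : hv 0 s = Pi.single 0 (gM s) := by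
  funext i
  rcases Nat.eq_zero_or_pos i with rfl | hi
  · rw [hv_apply_zero, Pi.single_eq_same, gM_cons, g_zero, one_mul]
  · rw [hv, gz_of_neg (by omega), Pi.single_eq_of_ne hi.ne', zero_mul]

/-- Each unit shift is a telescoping sum whose lower end vanishes. -/
theorem sum_range_sub_shift {M : Type*} [AddCommGroup M] (u : ℤ → M) (hu : ∀ e < 0, u e = 0)
    (m i : ℕ) :
    ∑ d ∈ Finset.range m, (u d - u ((d : ℤ) - i)) =
      ∑ k ∈ Finset.range i, u ((m : ℤ) - 1 - k) := by
  induction i with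
  | zero => simp
  | succ i ih =>
    rw [Finset.sum_range_succ, ← ih, ← sub_eq_iff_eq_add', ← Finset.sum_sub_distrib]
    have := Finset.sum_range_sub (fun d : ℕ => u ((d : ℤ) - (i + 1 : ℕ))) m
    rw [hu (((0 : ℕ) : ℤ) - (i + 1 : ℕ)) (by push_cast; omega), sub_zero] at this
    rw [show (m : ℤ) - 1 - i = m - (i + 1 : ℕ) by push_cast; ring, ← this]
    refine Finset.sum_congr rfl fun d _ => ?_
    rw [show ((d + 1 : ℕ) : ℤ) - (i + 1 : ℕ) = d - i by push_cast; ring]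
    abel

/-- With $u(e)=g_e\,g_{a+b-i-e}$ the right side is $\sum_d(u(d)-u(d-i))$, which collapses to a
window of `i` values of $u$. The bounds `b` and `a + 1` give windows that are exchanged by the
symmetry $e\mapsto a+b-i-e$ of $u$, so the smaller one may be used. -/
theorem sum_gz_mul_gz (a b i : ℕ) :
    ∑ k ∈ Finset.range i, gz ((b : ℤ) - 1 - k) * gz ((a : ℤ) - i + 1 + k) =
      ∑ d ∈ Finset.range (min (a + 1) b),
        (gz (((a + b - d : ℕ) : ℤ) - i) * gz d - gz ((d : ℤ) - i) * gz ((a + b - d : ℕ) : ℤ)) := by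
  have h1 : ∀ d ∈ Finset.range (min (a + 1) b),
      gz (((a + b - d : ℕ) : ℤ) - i) * gz d - gz ((d : ℤ) - i) * gz ((a + b - d : ℕ) : ℤ) =
      gz d * gz ((a : ℤ) + b - i - d) - gz ((d : ℤ) - i) * gz ((a : ℤ) + b - i - (d - i)) := by
    intro d hd
    rw [Finset.mem_range] at hd
    rw [mul_comm, Nat.cast_sub (by omega)]
    congr 3
    · push_cast; ring
    · push_cast; ring
  rw [Finset.sum_congr rfl h1,
    sum_range_sub_shift (fun e : ℤ => gz e * gz ((a : ℤ) + b - i - e)) (fun e he => by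
      simp only [gz_of_neg he, zero_mul])]
  rcases le_or_gt b (a + 1) with hab | hab
  · rw [min_eq_right hab]
    refine Finset.sum_congr rfl fun k _ => ?_
    congr 2
    ring
  · rw [min_eq_left hab.le, ← Finset.sum_range_reflect]
    refine Finset.sum_congr rfl fun k hk => ?_
    rw [Finset.mem_range] at hk
    rw [mul_comm, show i - 1 - k = i - (k + 1) by omega, Nat.cast_sub (by omega)]
    congr 2
    · push_cast; ring
    · push_cast; ring

theorem lax_hv_psum {N a : ℕ} (ha : a ≤ N) (i : ℕ) :
    ∑ j ∈ Finset.range (N + 1), psum (j - i) * gz ((a : ℤ) - j) =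
      (α * ((a : F) - i)) • gz ((a : ℤ) - i) := by
  rcases le_or_gt i N with hi | hi
  · rw [← Finset.sum_range_add_sum_Ico _ (show i ≤ N + 1 by omega), Finset.sum_Ico_eq_sum_range]
    rw [Finset.sum_eq_zero, zero_add]
    · have := newton (N + 1 - i) ((a : ℤ) - i) (by omega)
      push_cast at this
      rw [← this]
      refine Finset.sum_congr rfl fun k _ => ?_
      rw [Nat.add_sub_cancel_left]
      congr 2
      push_cast
      ring
    · intro j hj
      rw [Finset.mem_range] at hj
      rw [Nat.sub_eq_zero_of_le hj.le, psum_zero, zero_mul]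
  · rw [gz_of_neg (by omega), smul_zero]
    refine Finset.sum_eq_zero fun j hj => ?_
    rw [Finset.mem_range] at hj
    rw [Nat.sub_eq_zero_of_le (by omega), psum_zero, zero_mul]

/-- By the Leibniz rule: when $g_{a-j}$ is hit, each of the `i` indices `j < i` gives the same
$g_{a-i}g_s$; when a factor $g_b$ of $g_s$ is hit, the quadratic sums of `sum_gz_mul_gz` appear. -/
theorem lax_hv_skew {N a : ℕ} (ha : a ≤ N) (s : Multiset ℕ) (i : ℕ) :
    ∑ j ∈ Finset.range (N + 1), skew (i - j) (gz ((a : ℤ) - j) * gM s) =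
      (i : F) • hv a s i + (s.map fun b : ℕ =>
        (∑ k ∈ Finset.range i, gz ((b : ℤ) - 1 - k) * gz ((a : ℤ) - i + 1 + k)) *
          gM (s.erase b)).sum := by
  have h1 : ∑ j ∈ Finset.range (N + 1), skew (i - j) (gz ((a : ℤ) - j) * gM s) =
      ∑ j ∈ Finset.range i, skew (i - j) (gz ((a : ℤ) - j) * gM s) := by
    rcases le_or_gt i (N + 1) with hi | hi
    · symm
      refine Finset.sum_subset (Finset.range_mono hi) fun j _ hj => ?_
      rw [Finset.mem_range] at hj
      rw [Nat.sub_eq_zero_of_le (by omega), skew_zero, Derivation.coe_zero, Pi.zero_apply]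
    · refine Finset.sum_subset (Finset.range_mono hi.le) fun j _ hj => ?_
      rw [Finset.mem_range] at hj
      rw [gz_of_neg (by omega), zero_mul, map_zero]
  have h2 : ∀ j ∈ Finset.range i, skew (i - j) (gz ((a : ℤ) - j) * gM s) =
      hv a s i + (s.map fun b : ℕ =>
        gz ((b : ℤ) - (i - j : ℕ)) * gz ((a : ℤ) - j) * gM (s.erase b)).sum := by
    intro j hj
    rw [Finset.mem_range] at hj
    rw [Derivation.leibniz, skew_gz (by omega), skew_gM (by omega), add_comm, smul_eq_mul,
      smul_eq_mul, ← Multiset.sum_map_mul_left, hv, mul_comm (gM s)]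
    congr 1
    · congr 2
      rw [Nat.cast_sub hj.le]
      ring
    · refine congrArg Multiset.sum (Multiset.map_congr rfl fun b _ => ?_)
      ring
  rw [h1, Finset.sum_congr rfl h2, Finset.sum_add_distrib, Finset.sum_const, Finset.card_range,
    ← Multiset.sum_map_sum, Nat.cast_smul_eq_nsmul]
  congr 1
  refine congrArg Multiset.sum (Multiset.map_congr rfl fun b _ => ?_)
  rw [← Finset.sum_mul, ← Finset.sum_range_reflect]
  congr 1
  refine Finset.sum_congr rfl fun k hk => ?_
  rw [Finset.mem_range] at hk
  rw [show i - (i - 1 - k) = k + 1 by omega, show i - 1 - k = i - (k + 1) by omega,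
    Nat.cast_sub (by omega)]
  congr 2
  · push_cast; ring
  · push_cast; ring

/-- The dependence on the coordinate cancels, $\alpha(a-i)+(\alpha-1)i+i=\alpha a$, which is the
purpose of the diagonal $(\alpha-1)i$. What remains only redistributes size between the
distinguished entry `a` and another entry `b`. -/
theorem lax_hv {N a : ℕ} (ha : a ≤ N) (s : Multiset ℕ) :
    lax N (hv a s) = (α * (a : F)) • hv a s + (s.map fun b : ℕ =>
      ∑ d ∈ Finset.range (min (a + 1) b),
        (hv (a + b - d) (d ::ₘ s.erase b) - hv d ((a + b - d) ::ₘ s.erase b))).sum := by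
  funext i
  rw [lax_apply]
  have hev : ∀ (S : Multiset (ℕ → Sym)), S.sum i = (S.map fun f => f i).sum := fun S =>
    map_multiset_sum (Pi.evalAddMonoidHom (fun _ : ℕ => Sym) i) S
  simp only [laxEntry_apply, Finset.sum_add_distrib]
  rw [Pi.add_apply, Pi.smul_apply, hev, Multiset.map_map]
  have h1 : ∑ j ∈ Finset.range (N + 1), psum (j - i) * hv a s j =
      (α * ((a : F) - i)) • hv a s i := by
    simp only [hv, ← mul_assoc, ← Finset.sum_mul, lax_hv_psum ha i, smul_mul_assoc]
  have h3 : (∑ j ∈ Finset.range (N + 1), if i = j then ((α - 1) * (i : F)) • hv a s j else 0) =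
      ((α - 1) * (i : F)) • hv a s i := by
    rw [Finset.sum_ite_eq]
    split_ifs with h
    · rfl
    · rw [Finset.mem_range] at h
      rw [hv, gz_of_neg (by omega), zero_mul, smul_zero]
  rw [h1, h3]
  have h2 := lax_hv_skew ha s i
  change ∑ j ∈ Finset.range (N + 1), skew (i - j) (hv a s j) = _ at h2
  rw [h2, ← add_assoc, ← add_smul, add_right_comm, ← add_smul]
  congr 1
  · congr 1
    ring
  · refine congrArg Multiset.sum (Multiset.map_congr rfl fun b _ => ?_)
    rw [Function.comp_apply, Finset.sum_apply, sum_gz_mul_gz, Finset.sum_mul]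
    refine Finset.sum_congr rfl fun d _ => ?_
    rw [Pi.sub_apply, hv, hv, gM_cons, gM_cons, gz_natCast, gz_natCast]
    ring

/-! ### Rows and parts of partitions -/

namespace Ptn

theorem length_rows (l : Ptn) : l.rows.length = l.length := Multiset.length_sort _

theorem coe_rows (l : Ptn) : (l.rows : Multiset ℕ) = l.parts := Multiset.sort_eq _ _

theorem row_eq_zero (l : Ptn) {i : ℕ} (h : l.length ≤ i) : l.row i = 0 :=
  List.getD_eq_default _ _ (by rwa [length_rows])

theorem row_anti (l : Ptn) {i j : ℕ} (h : i ≤ j) : l.row j ≤ l.row i := by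
  rcases h.eq_or_lt with rfl | h
  · exact le_rfl
  · exact l.row_antitone h

theorem parts_eq_map_row (l : Ptn) : l.parts = (Finset.range l.length).val.map l.row := by
  rw [← coe_rows l, Finset.range_val, ← Multiset.coe_range, Multiset.map_coe, Multiset.coe_eq_coe]
  refine List.Perm.of_eq (List.ext_getElem (by simp [length_rows]) fun i h1 h2 => ?_)
  rw [List.getElem_map, List.getElem_range, row, List.getD_eq_getElem _ _ h1]

theorem sum_map_parts {M : Type*} [AddCommMonoid M] (l : Ptn) (f : ℕ → M) :
    (l.parts.map f).sum = ∑ t ∈ Finset.range l.length, f (l.row t) := by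
  conv_lhs => rw [parts_eq_map_row l]
  rw [Multiset.map_map]
  rfl

theorem sum_map_parts_of_le {M : Type*} [AddCommMonoid M] (l : Ptn) {f : ℕ → M} (hf : f 0 = 0)
    {n : ℕ} (hn : l.length ≤ n) :
    (l.parts.map f).sum = ∑ t ∈ Finset.range n, f (l.row t) := by
  rw [sum_map_parts]
  refine Finset.sum_subset (Finset.range_mono hn) fun t _ ht => ?_
  rw [row_eq_zero l (by simpa using ht), hf]

theorem weight_eq_sum_row (l : Ptn) {n : ℕ} (hn : l.length ≤ n) :
    l.weight = ∑ t ∈ Finset.range n, l.row t := by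
  rw [weight, ← Multiset.map_id l.parts, sum_map_parts_of_le l (f := id) rfl hn]
  rfl

theorem length_le_weight (l : Ptn) : l.length ≤ l.weight := by
  have := Multiset.card_nsmul_le_sum (s := l.parts) (a := 1) fun x hx => l.pos x hx
  rwa [nsmul_one] at this

theorem row_pos (l : Ptn) {i : ℕ} (h : i < l.length) : 0 < l.row i := by
  refine l.pos _ ?_
  rw [parts_eq_map_row]
  exact Multiset.mem_map_of_mem _ (Finset.mem_def.1 (Finset.mem_range.2 h))

theorem ext_row {l m : Ptn} (h : ∀ t, l.row t = m.row t) : l = m := by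
  have key : ∀ a b : Ptn, (∀ t, a.row t = b.row t) → a.length ≤ b.length := by
    intro a b hab
    by_contra hlt
    have := a.row_pos (not_le.1 hlt)
    rw [hab, row_eq_zero b le_rfl] at this
    omega
  have hlen : l.length = m.length := le_antisymm (key _ _ h) (key _ _ fun t => (h t).symm)
  ext1
  rw [parts_eq_map_row l, parts_eq_map_row m, hlen]
  exact Multiset.map_congr rfl fun t _ => h t

/-! ### The dominance order -/

theorem Dominated.refl (l : Ptn) : l.Dominated l := ⟨rfl, fun _ => le_rfl⟩

theorem Dominated.trans {k l m : Ptn} (h : k.Dominated l) (h' : l.Dominated m) : k.Dominated m :=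
  ⟨h.1.trans h'.1, fun n => (h.2 n).trans (h'.2 n)⟩

theorem Dominated.antisymm {l m : Ptn} (h : l.Dominated m) (h' : m.Dominated l) : l = m := by
  refine ext_row fun t => ?_
  have h1 := le_antisymm (h.2 t) (h'.2 t)
  have h2 := le_antisymm (h.2 (t + 1)) (h'.2 (t + 1))
  rw [Finset.sum_range_succ, Finset.sum_range_succ] at h2
  omega

/-- Strict dominance. -/
def StrictDom (m l : Ptn) : Prop := m.Dominated l ∧ m ≠ l

theorem StrictDom.trans_right {k l m : Ptn} (h : k.StrictDom l) (h' : l.Dominated m) :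
    k.StrictDom m :=
  ⟨h.1.trans h', by rintro rfl; exact h.2 (h.1.antisymm h')⟩

theorem StrictDom.trans_left {k l m : Ptn} (h : k.Dominated l) (h' : l.StrictDom m) :
    k.StrictDom m :=
  ⟨h.trans h'.1, by rintro rfl; exact h'.2 (h'.1.antisymm h)⟩

/-- The statistic `∑ i λ_i`. -/
def moment (l : Ptn) : ℕ := ∑ t ∈ Finset.range l.length, (t + 1) * l.row t

theorem moment_eq (l : Ptn) {n : ℕ} (hn : l.length ≤ n) :
    l.moment = ∑ t ∈ Finset.range n, (t + 1) * l.row t := by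
  refine Finset.sum_subset (Finset.range_mono hn) fun t _ ht => ?_
  rw [row_eq_zero l (by simpa using ht), mul_zero]

theorem moment_add (l : Ptn) {n : ℕ} (hn : l.length ≤ n) :
    l.moment + ∑ k ∈ Finset.range (n + 1), ∑ t ∈ Finset.range k, l.row t = (n + 1) * l.weight := by
  have key : ∀ (f : ℕ → ℕ) (n : ℕ), ∑ t ∈ Finset.range n, (t + 1) * f t +
      ∑ k ∈ Finset.range (n + 1), ∑ t ∈ Finset.range k, f t =
      (n + 1) * ∑ t ∈ Finset.range n, f t := by
    intro f n
    induction n with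
    | zero => simp
    | succ n ih =>
      rw [Finset.sum_range_succ _ (n + 1), Finset.sum_range_succ _ n, Finset.sum_range_succ f n]
      linarith
  rw [moment_eq l hn, key, ← weight_eq_sum_row l hn]

/-- Summation by parts (`moment_add`) turns the moment into a constant minus the total of the
partial sums, one of which is strictly larger for `l`. -/
theorem StrictDom.moment_lt {m l : Ptn} (h : m.StrictDom l) : l.moment < m.moment := by
  have hm := moment_add m (le_max_left m.length l.length)
  have hl := moment_add l (le_max_right m.length l.length)
  rw [h.1.1] at hm
  obtain ⟨k, hk⟩ : ∃ k, ∑ t ∈ Finset.range k, m.row t < ∑ t ∈ Finset.range k, l.row t := by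
    by_contra hcon
    push Not at hcon
    exact h.2 (h.1.antisymm ⟨h.1.1.symm, hcon⟩)
  have hkle : k ∈ Finset.range (max m.length l.length + 1) := by
    rw [Finset.mem_range]
    by_contra hcon
    rw [← weight_eq_sum_row m (by omega), ← weight_eq_sum_row l (by omega), h.1.1] at hk
    omega
  have := Finset.sum_lt_sum (fun i (_ : i ∈ Finset.range (max m.length l.length + 1)) => h.1.2 i)
    ⟨k, hkle, hk⟩
  omega

theorem moment_le (l : Ptn) : l.moment ≤ l.weight * l.weight := by
  rw [moment, weight_eq_sum_row l le_rfl, Finset.mul_sum, ← weight_eq_sum_row l le_rfl]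
  refine Finset.sum_le_sum fun t ht => Nat.mul_le_mul_right _ ?_
  rw [Finset.mem_range] at ht
  exact ht.trans_le l.length_le_weight

/-- Induction upwards from the bottom of the dominance order. -/
theorem dominance_induction {p : Ptn → Prop} (H : ∀ l, (∀ m, m.StrictDom l → p m) → p l)
    (l : Ptn) : p l := by
  induction hn : l.weight * l.weight - l.moment using Nat.strong_induction_on generalizing l with
  | _ n ih =>
    refine H l fun m hm => ih _ ?_ m rfl
    have h1 := hm.moment_lt
    have h2 := m.moment_le
    have h3 := hm.1.1
    rw [h3] at h2 ⊢
    omega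

/-- Induction downwards from the top of the dominance order. -/
theorem dominance_induction_down {p : Ptn → Prop} (H : ∀ l, (∀ m, l.StrictDom m → p m) → p l)
    (l : Ptn) : p l := by
  induction hn : l.moment using Nat.strong_induction_on generalizing l with
  | _ n ih => exact H l fun m hm => ih _ (hn ▸ hm.moment_lt) m rfl

/-! ### Majorization of multisets -/

/-- The majorization preorder, in terms of the convex functions `b ↦ max (b - x) 0`. -/
def Maj (s t : Multiset ℕ) : Prop :=
  s.sum = t.sum ∧ ∀ x, (s.map (· - x)).sum ≤ (t.map (· - x)).sum

theorem Maj.refl (s : Multiset ℕ) : Maj s s := ⟨rfl, fun _ => le_rfl⟩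

theorem Maj.trans {s t u : Multiset ℕ} (h : Maj s t) (h' : Maj t u) : Maj s u :=
  ⟨h.1.trans h'.1, fun x => (h.2 x).trans (h'.2 x)⟩

/-- Convex sums grow when two entries with fixed sum are spread apart. In this form the comparison
needs no sorting and tolerates zero entries, both of which matter for the Lax operator. -/
theorem maj_pair {a b d : ℕ} (ha : d ≤ a) (hb : d ≤ b) (u : Multiset ℕ) :
    Maj (a ::ₘ b ::ₘ u) ((a + b - d) ::ₘ d ::ₘ u) := by
  constructor
  · simp only [Multiset.sum_cons]
    omega
  · intro x
    simp only [Multiset.map_cons, Multiset.sum_cons]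
    omega

theorem not_maj_pair {a b d : ℕ} (ha : d < a) (hb : d < b) (u : Multiset ℕ) :
    ¬ Maj ((a + b - d) ::ₘ d ::ₘ u) (a ::ₘ b ::ₘ u) := by
  intro h
  -- At this threshold `a` and `b` contribute nothing while `a + b - d` still exceeds it; the
  -- contributions of `u` cancel.
  have := h.2 (max a b)
  simp only [Multiset.map_cons, Multiset.sum_cons] at this
  omega

theorem sum_map_filter_pos {M : Type*} [AddCommMonoid M] {f : ℕ → M} (hf : f 0 = 0)
    (s : Multiset ℕ) : ((s.filter (0 < ·)).map f).sum = (s.map f).sum := by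
  induction s using Multiset.induction_on with
  | empty => simp
  | cons a s ih =>
    rcases Nat.eq_zero_or_pos a with rfl | h
    · rw [Multiset.filter_cons_of_neg (p := (0 < ·)) _ (lt_irrefl 0), ih, Multiset.map_cons,
        Multiset.sum_cons, hf, zero_add]
    · rw [Multiset.filter_cons_of_pos (p := (0 < ·)) _ h, Multiset.map_cons, Multiset.map_cons,
        Multiset.sum_cons, Multiset.sum_cons, ih]

/-- The partition formed by the positive elements of a multiset. -/
def ofMultiset (s : Multiset ℕ) : Ptn := ⟨s.filter (0 < ·), fun _ hi => (Multiset.mem_filter.1 hi).2⟩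

theorem weight_ofMultiset (s : Multiset ℕ) : (ofMultiset s).weight = s.sum := by
  have := sum_map_filter_pos (f := id) rfl s
  rwa [Multiset.map_id, Multiset.map_id] at this

theorem maj_filter (s : Multiset ℕ) : Maj s (s.filter (0 < ·)) ∧ Maj (s.filter (0 < ·)) s := by
  have h1 : (s.filter (0 < ·)).sum = s.sum := weight_ofMultiset s
  have h2 : ∀ x, ((s.filter (0 < ·)).map (· - x)).sum = (s.map (· - x)).sum := fun x =>
    sum_map_filter_pos (f := (· - x)) (Nat.zero_sub x) s
  exact ⟨⟨h1.symm, fun x => (h2 x).ge⟩, ⟨h1, fun x => (h2 x).le⟩⟩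

/-- Take the threshold $x$ to be row `n` of `l`. The first `n` rows of `m` sum to at most
$nx+\sum(m_t-x)^+\le nx+\sum(l_t-x)^+$, and the last expression is the sum of the first `n` rows of
`l`, since no later row exceeds $x$. -/
theorem dominated_of_maj {m l : Ptn} (h : Maj m.parts l.parts) : m.Dominated l := by
  refine ⟨h.1, fun n => ?_⟩
  set M := max n (max m.length l.length) with hM
  have hx := h.2 (l.row n)
  rw [sum_map_parts_of_le m (f := (· - l.row n)) (Nat.zero_sub _) (n := M) (by omega),
    sum_map_parts_of_le l (f := (· - l.row n)) (Nat.zero_sub _) (n := M) (by omega)] at hx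
  have h1 : ∑ t ∈ Finset.range n, m.row t ≤
      n * l.row n + ∑ t ∈ Finset.range n, (m.row t - l.row n) := by
    have : n * l.row n = ∑ _t ∈ Finset.range n, l.row n := by simp
    rw [this, ← Finset.sum_add_distrib]
    exact Finset.sum_le_sum fun t _ => by omega
  have h2 : ∑ t ∈ Finset.range n, (m.row t - l.row n) ≤
      ∑ t ∈ Finset.range M, (m.row t - l.row n) :=
    Finset.sum_le_sum_of_subset (Finset.range_mono (by omega))
  have h3 : ∑ t ∈ Finset.range M, (l.row t - l.row n) =
      ∑ t ∈ Finset.range n, (l.row t - l.row n) := by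
    symm
    refine Finset.sum_subset (Finset.range_mono (by omega)) fun t _ ht => ?_
    rw [Finset.mem_range, not_lt] at ht
    exact Nat.sub_eq_zero_of_le (l.row_anti ht)
  have h4 : n * l.row n + ∑ t ∈ Finset.range n, (l.row t - l.row n) =
      ∑ t ∈ Finset.range n, l.row t := by
    have : n * l.row n = ∑ _t ∈ Finset.range n, l.row n := by simp
    rw [this, ← Finset.sum_add_distrib]
    refine Finset.sum_congr rfl fun t ht => ?_
    have := l.row_anti (Finset.mem_range.1 ht).le
    omega
  omega

theorem strictDom_of_maj {l : Ptn} {t : Multiset ℕ} (h : Maj l.parts t) (h' : ¬ Maj t l.parts) :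
    l.StrictDom (ofMultiset t) := by
  refine ⟨dominated_of_maj (h.trans (maj_filter t).1), ?_⟩
  intro heq
  refine h' ?_
  rw [heq]
  exact (maj_filter t).1

/-! ### Moving up operators -/

/-- The parts of a partition outside the rows `i` and `j`. -/
def restParts (l : Ptn) (i j : ℕ) : Multiset ℕ :=
  (((Finset.range l.length).erase i).erase j).val.map l.row

theorem restParts_comm (l : Ptn) (i j : ℕ) : l.restParts i j = l.restParts j i := by
  rw [restParts, restParts, Finset.erase_right_comm]

theorem parts_eq_cons (l : Ptn) {i j : ℕ} (hi : i < l.length) (hj : j < l.length) (hij : i ≠ j) :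
    l.parts = l.row i ::ₘ l.row j ::ₘ l.restParts i j := by
  have hj' : j ∈ (Finset.range l.length).erase i :=
    Finset.mem_erase.2 ⟨hij.symm, Finset.mem_range.2 hj⟩
  conv_lhs => rw [parts_eq_map_row l, ← Multiset.cons_erase (Finset.mem_def.1
    (Finset.mem_range.2 hi)), ← Finset.erase_val, ← Multiset.cons_erase (Finset.mem_def.1 hj'),
    ← Finset.erase_val, Multiset.map_cons, Multiset.map_cons]
  rfl

theorem IsMove.lt_length {l : Ptn} {i j k : ℕ} (h : l.IsMove i j k) :
    i < l.length ∧ j < l.length := by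
  have : j < l.length := by
    by_contra hj
    have := l.row_eq_zero (not_lt.1 hj)
    have := h.2
    omega
  exact ⟨h.1.trans this, this⟩

theorem parts_moveUp {l : Ptn} {i j k : ℕ} (h : l.IsMove i j k) :
    l.moveUp i j k = ofMultiset ((l.row i + k) ::ₘ (l.row j - k) ::ₘ l.restParts i j) := by
  ext1
  refine Multiset.ext.2 fun w => ?_
  rcases Nat.eq_zero_or_pos w with rfl | hw
  · rw [Multiset.count_eq_zero_of_notMem fun h0 => lt_irrefl _ ((l.moveUp i j k).pos 0 h0),
      Multiset.count_eq_zero_of_notMem fun h0 => lt_irrefl _ ((ofMultiset _).pos 0 h0)]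
  · have h1 := l.count_moveUp h w hw
    rw [parts_eq_cons l h.lt_length.1 h.lt_length.2 h.1.ne, Multiset.count_cons,
      Multiset.count_cons] at h1
    rw [ofMultiset, Multiset.count_filter_of_pos (p := (0 < ·)) hw, Multiset.count_cons,
      Multiset.count_cons]
    simp only [eq_comm (a := w)] at h1 ⊢
    omega

theorem strictDom_moveUp {l : Ptn} {i j k : ℕ} (h : l.IsMove i j k) :
    l.StrictDom (l.moveUp i j k) := by
  have hr := l.row_antitone h.1
  obtain ⟨-, hk, hkj⟩ := id h
  have h1 := maj_pair (a := l.row i) (b := l.row j) (d := l.row j - k) (by omega) (by omega)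
    (l.restParts i j)
  have h2 := not_maj_pair (a := l.row i) (b := l.row j) (d := l.row j - k) (by omega) (by omega)
    (l.restParts i j)
  rw [← parts_eq_cons l h.lt_length.1 h.lt_length.2 h.1.ne,
    show l.row i + l.row j - (l.row j - k) = l.row i + k by omega] at h1 h2
  rw [parts_moveUp h]
  exact strictDom_of_maj h1 h2

theorem moveUp_congr {l : Ptn} {i j k i' j' : ℕ} (h : l.IsMove i j k) (h' : l.IsMove i' j' k)
    (hi : l.row i = l.row i') (hj : l.row j = l.row j') : l.moveUp i j k = l.moveUp i' j' k := by
  rw [parts_moveUp h, parts_moveUp h', hi, hj]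
  have h1 := parts_eq_cons l h.lt_length.1 h.lt_length.2 h.1.ne
  have h2 := parts_eq_cons l h'.lt_length.1 h'.lt_length.2 h'.1.ne
  rw [h2, hi, hj, Multiset.cons_inj_right, Multiset.cons_inj_right] at h1
  rw [h1]

/-- The moving up operators of a partition. -/
def moves (l : Ptn) : Finset (ℕ × ℕ × ℕ) :=
  (Finset.range l.length ×ˢ Finset.range l.length ×ˢ Finset.range (l.weight + 1)).filter
    fun t => l.IsMove t.1 t.2.1 t.2.2

theorem row_le_weight (l : Ptn) (i : ℕ) : l.row i ≤ l.weight := by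
  rcases lt_or_ge i l.length with h | h
  · rw [weight_eq_sum_row l le_rfl]
    exact Finset.single_le_sum (f := l.row) (fun _ _ => Nat.zero_le _) (Finset.mem_range.2 h)
  · rw [row_eq_zero l h]
    exact Nat.zero_le _

theorem mem_moves {l : Ptn} {t : ℕ × ℕ × ℕ} : t ∈ l.moves ↔ l.IsMove t.1 t.2.1 t.2.2 := by
  rw [moves, Finset.mem_filter, and_iff_right_iff_imp]
  intro h
  have := l.row_le_weight t.2.1
  have := h.2.2
  simp only [Finset.mem_product, Finset.mem_range]
  exact ⟨h.lt_length.1, h.lt_length.2, by omega⟩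

/-- The moving up of a partition as a finite set. -/
def upper (l : Ptn) : Finset Ptn := l.moves.image fun t => l.moveUp t.1 t.2.1 t.2.2

theorem mem_upper {l m : Ptn} : m ∈ l.upper ↔ m ∈ l.movingUp := by
  rw [upper, Finset.mem_image]
  constructor
  · rintro ⟨t, ht, rfl⟩
    exact ⟨_, _, _, mem_moves.1 ht, rfl⟩
  · rintro ⟨i, j, k, h, rfl⟩
    exact ⟨(i, j, k), mem_moves.2 h, rfl⟩

theorem strictDom_of_mem_upper {l m : Ptn} (h : m ∈ l.upper) : l.StrictDom m := by
  obtain ⟨t, ht, rfl⟩ := Finset.mem_image.1 h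
  exact strictDom_moveUp (mem_moves.1 ht)

end Ptn

/-! ### Distinct values of `e'` on comparable partitions -/

theorem α_mul_eq {a b : ℚ} (h : α * (a : F) = (b : F)) : b = 0 := by
  have h1 : algebraMap (Polynomial ℚ) F (Polynomial.X * Polynomial.C a) =
      algebraMap (Polynomial ℚ) F (Polynomial.C b) := by
    rw [map_mul, RatFunc.algebraMap_X, RatFunc.algebraMap_C, RatFunc.algebraMap_C]
    simpa using h
  have h2 := congrArg (fun p => Polynomial.coeff p 0) (RatFunc.algebraMap_injective ℚ h1)
  simpa using h2.symm

theorem e'_eq (l : Ptn) : ∃ a : ℚ, e' l = α * (a : F) - (l.moment : F) := by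
  refine ⟨(∑ t ∈ Finset.range l.length, (l.row t : ℚ) ^ 2) / 2, ?_⟩
  rw [e', Ptn.moment]
  push_cast
  ring

/-- The constant term of $e'$ in $\alpha$ is $-\sum_i i\lambda_i$, and this is strictly monotone for
dominance. -/
theorem e'_ne {l m : Ptn} (h : l.StrictDom m) : e' l ≠ e' m := by
  intro heq
  obtain ⟨a, ha⟩ := e'_eq l
  obtain ⟨b, hb⟩ := e'_eq m
  rw [ha, hb, sub_eq_sub_iff_sub_eq_sub, ← mul_sub] at heq
  have := α_mul_eq (a := a - b) (b := l.moment - m.moment) (by exact_mod_cast heq)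
  have h1 : (l.moment : ℚ) = m.moment := by linarith
  exact h.moment_lt.ne' (by exact_mod_cast h1)

/-! ### The Laplace–Beltrami operator -/

theorem gP_ofMultiset (s : Multiset ℕ) : gP (Ptn.ofMultiset s) = gM s := gM_filter s

/-- Coordinate 0 of `hv a s` does not see which entry is distinguished, so the exchange terms of
`lax_hv` cancel in pairs. -/
theorem lax_hv_zero {N a : ℕ} (ha : a ≤ N) (s : Multiset ℕ) :
    lax N (hv a s) 0 = (α * (a : F)) • gM (a ::ₘ s) := by
  have hev : ∀ (S : Multiset (ℕ → Sym)), S.sum 0 = (S.map fun f => f 0).sum := fun S =>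
    map_multiset_sum (Pi.evalAddMonoidHom (fun _ : ℕ => Sym) 0) S
  rw [lax_hv ha, Pi.add_apply, Pi.smul_apply, hv_apply_zero, hev, Multiset.map_map, add_eq_left]
  refine Multiset.sum_eq_zero fun x hx => ?_
  obtain ⟨b, -, rfl⟩ := Multiset.mem_map.1 hx
  rw [Function.comp_apply, Finset.sum_apply]
  refine Finset.sum_eq_zero fun d _ => ?_
  rw [Pi.sub_apply, hv_apply_zero, hv_apply_zero, Multiset.cons_swap, sub_self]

theorem lax_sq_hv_zero {N a : ℕ} {s : Multiset ℕ} (ha : a + s.sum ≤ N) :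
    (lax N ^ 2) (hv a s) 0 = (α * (a : F)) ^ 2 • gM (a ::ₘ s) +
      (s.map fun b : ℕ => ∑ d ∈ Finset.range (min (a + 1) b),
        (α * ((a : F) + b - 2 * d)) • gM ((a + b - d) ::ₘ d ::ₘ s.erase b)).sum := by
  have hev : ∀ (S : Multiset (ℕ → Sym)), lax N S.sum 0 = (S.map fun f => lax N f 0).sum := fun S =>
    map_multiset_sum ((Pi.evalAddMonoidHom (fun _ : ℕ => Sym) 0).comp (lax N).toAddMonoidHom) S
  rw [pow_two, Module.End.mul_apply, lax_hv (by omega), map_add, Pi.add_apply, map_smul,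
    Pi.smul_apply, lax_hv_zero (by omega), smul_smul, ← pow_two, hev, Multiset.map_map]
  congr 1
  refine congrArg Multiset.sum (Multiset.map_congr rfl fun b hb => ?_)
  rw [Function.comp_apply, map_sum, Finset.sum_apply]
  have hb' : b ≤ s.sum := Multiset.single_le_sum (fun _ _ => Nat.zero_le _) b hb
  refine Finset.sum_congr rfl fun d hd => ?_
  rw [Finset.mem_range] at hd
  rw [map_sub, Pi.sub_apply, lax_hv_zero (by omega), lax_hv_zero (by omega), Multiset.cons_swap,
    ← sub_smul, Nat.cast_sub (by omega)]
  congr 1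
  push_cast
  ring

theorem hv_cons_zero (a : ℕ) (s : Multiset ℕ) : hv a (0 ::ₘ s) = hv a s := by
  funext i
  rw [hv, hv, gM_cons, g_zero, one_mul]

/-- For `a = 0` only `d = 0` is left: a part `b` becomes the distinguished entry and leaves behind a
zero, which `hv_cons_zero` drops. -/
theorem lax_single {N : ℕ} {s : Multiset ℕ} (hs : ∀ b ∈ s, 0 < b) :
    lax N (hv 0 s) = (s.map fun b : ℕ => (hv b (s.erase b) - hv 0 s)).sum := by
  rw [lax_hv (Nat.zero_le _), Nat.cast_zero, mul_zero, zero_smul, zero_add]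
  refine congrArg Multiset.sum (Multiset.map_congr rfl fun b hb => ?_)
  have := hs b hb
  rw [min_eq_left (by omega), Finset.sum_range_one, zero_add, tsub_zero, hv_cons_zero,
    Multiset.cons_erase hb]

/-- The first application distinguishes a part `b`, the second exchanges size between `b` and
another part `c`, and the third reads off `α` times the distinguished entry. The subtracted term
comes from the `- hv 0 s` in `lax_single`, once for each part. -/
theorem vac_three {N : ℕ} {s : Multiset ℕ} (hs : ∀ b ∈ s, 0 < b) (hN : s.sum ≤ N) :
    vac N 3 (gM s) = (s.map fun b : ℕ => (α * (b : F)) ^ 2 • gM s +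
      ((s.erase b).map fun c : ℕ => ∑ d ∈ Finset.range (min (b + 1) c),
        (α * ((b : F) + c - 2 * d)) • gM ((b + c - d) ::ₘ d ::ₘ (s.erase b).erase c)).sum).sum -
      (α * (s.sum : F) * (s.card : F)) • gM s := by
  have hev : ∀ (k : ℕ) (S : Multiset (ℕ → Sym)),
      (lax N ^ k) S.sum 0 = (S.map fun f => (lax N ^ k) f 0).sum := fun k S =>
    map_multiset_sum ((Pi.evalAddMonoidHom (fun _ : ℕ => Sym) 0).comp
      (lax N ^ k).toAddMonoidHom) S
  have hle : ∀ b ∈ s, b + (s.erase b).sum = s.sum := by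
    intro b hb
    rw [← Multiset.sum_cons, Multiset.cons_erase hb]
  have h0 : (lax N ^ 2) (hv 0 s) 0 = (α * (s.sum : F)) • gM s := by
    rw [pow_two, Module.End.mul_apply, lax_single hs]
    have := hev 1 (s.map fun b : ℕ => (hv b (s.erase b) - hv 0 s))
    rw [pow_one] at this
    rw [this, Multiset.map_map, Nat.cast_multiset_sum, ← Multiset.sum_map_mul_left,
      Multiset.sum_smul, Multiset.map_map]
    refine congrArg Multiset.sum (Multiset.map_congr rfl fun b hb => ?_)
    have := hle b hb
    rw [Function.comp_apply, map_sub, Pi.sub_apply, lax_hv_zero (by omega),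
      lax_hv_zero (by omega), Nat.cast_zero, mul_zero, zero_smul, sub_zero,
      Multiset.cons_erase hb]
    rfl
  rw [vac_apply, ← hv_zero, pow_succ, Module.End.mul_apply, lax_single hs, hev, Multiset.map_map]
  rw [Multiset.map_congr rfl fun b hb => by
    rw [Function.comp_apply, map_sub, Pi.sub_apply, h0, lax_sq_hv_zero (by rw [hle b hb]; exact hN),
      Multiset.cons_erase hb], Multiset.sum_map_sub]
  congr 1
  rw [Multiset.map_const', Multiset.sum_replicate, ← Nat.cast_smul_eq_nsmul F, smul_smul]
  congr 1
  ring

/-- The sum over ordered pairs of distinct indices, folded along the diagonal. -/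
theorem sum_erase_eq_sum_lt {M : Type*} [AddCommMonoid M] (n : ℕ) (G : ℕ → ℕ → M) :
    ∑ i ∈ Finset.range n, ∑ j ∈ (Finset.range n).erase i, G i j =
      ∑ j ∈ Finset.range n, ∑ i ∈ Finset.range j, (G i j + G j i) := by
  induction n with
  | zero => simp
  | succ n ih =>
    rw [Finset.sum_range_succ, Finset.sum_range_succ, ← ih]
    have h1 : (Finset.range (n + 1)).erase n = Finset.range n := by
      rw [Finset.range_add_one, Finset.erase_insert Finset.notMem_range_self]
    have h2 : ∀ i ∈ Finset.range n, ∑ j ∈ (Finset.range (n + 1)).erase i, G i j =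
        ∑ j ∈ (Finset.range n).erase i, G i j + G i n := by
      intro i hi
      rw [Finset.mem_range] at hi
      rw [Finset.range_add_one, Finset.erase_insert_of_ne (by omega), Finset.sum_insert, add_comm]
      simp
    rw [Finset.sum_congr rfl h2, Finset.sum_add_distrib, h1, Finset.sum_add_distrib, add_assoc]

theorem sum_lt_sub {x : ℕ → F} (n : ℕ) :
    ∑ j ∈ Finset.range n, ∑ i ∈ Finset.range j, (x i - x j) =
      ∑ t ∈ Finset.range n, ((n : F) - 1 - 2 * t) * x t := by
  induction n with
  | zero => simp
  | succ n ih =>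
    rw [Finset.sum_range_succ, ih, Finset.sum_range_succ, Finset.sum_sub_distrib,
      Finset.sum_const, Finset.card_range, nsmul_eq_mul, ← add_sub_assoc, ← Finset.sum_add_distrib,
      sub_eq_add_neg]
    congr 1
    · refine Finset.sum_congr rfl fun t _ => ?_
      push_cast
      ring
    · push_cast
      ring

/-- The Laplace–Beltrami operator in degree `n`. -/
def lap (n : ℕ) : Sym →ₗ[F] Sym := (2 * α)⁻¹ • vac n 3 - ((n : F) / 2) • LinearMap.id

theorem form_lap (n : ℕ) (f h : Sym) : form (lap n f) h = form f (lap n h) := by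
  simp only [lap, LinearMap.sub_apply, LinearMap.smul_apply, LinearMap.id_apply, map_sub, map_smul,
    form_vac]

/-- The contributions of the two orderings of a pair of rows to the Laplace–Beltrami operator. -/
theorem pair_contribution (l : Ptn) {i j : ℕ} (hij : i < j) (hj : j < l.length) :
    (∑ d ∈ Finset.range (min (l.row i + 1) (l.row j)), (α * ((l.row i : F) + l.row j - 2 * d)) •
        gM ((l.row i + l.row j - d) ::ₘ d ::ₘ l.restParts i j)) +
      (∑ d ∈ Finset.range (min (l.row j + 1) (l.row i)), (α * ((l.row j : F) + l.row i - 2 * d)) •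
        gM ((l.row j + l.row i - d) ::ₘ d ::ₘ l.restParts j i)) =
    (2 * α) • (∑ k ∈ Finset.range (l.row j), ((l.row i : F) - l.row j + 2 * (k + 1 : ℕ)) •
        gP (l.moveUp i j (k + 1))) + (α * ((l.row i : F) - l.row j)) • gP l := by
  have hr := l.row_antitone hij
  have hS : ∑ d ∈ Finset.range (l.row j), (α * ((l.row i : F) + l.row j - 2 * d)) •
        gM ((l.row i + l.row j - d) ::ₘ d ::ₘ l.restParts i j) =
      α • (∑ k ∈ Finset.range (l.row j), ((l.row i : F) - l.row j + 2 * (k + 1 : ℕ)) •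
        gP (l.moveUp i j (k + 1))) := by
    -- The reflection `d = λ_j - (k + 1)` replaces the size left in the lower row by the number of
    -- squares moved.
    rw [Finset.smul_sum, ← Finset.sum_range_reflect]
    refine Finset.sum_congr rfl fun k hk => ?_
    rw [Finset.mem_range] at hk
    rw [Ptn.parts_moveUp ⟨hij, by omega, by omega⟩, gP_ofMultiset, smul_smul,
      show l.row j - 1 - k = l.row j - (k + 1) by omega,
      show l.row i + l.row j - (l.row j - (k + 1)) = l.row i + (k + 1) by omega,
      Nat.cast_sub (by omega)]
    congr 1
    ring
  have hgl : gP l = gM (l.row i ::ₘ l.row j ::ₘ l.restParts i j) := by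
    rw [gP, ← l.parts_eq_cons (hij.trans hj) hj hij.ne]
  rw [min_eq_right (by omega), hS, l.restParts_comm j i, add_comm (l.row j : F),
    add_comm (l.row j) (l.row i), two_mul, add_smul, add_assoc]
  congr 1
  -- For equal rows both orderings give the same moves. For `λ_i > λ_j` the second ordering has the
  -- additional index `d = λ_j`, which reproduces $g_\lambda$ itself and feeds the diagonal.
  rcases hr.eq_or_lt with h | h
  · rw [min_eq_right (by omega), ← hS, h, sub_self, mul_zero, zero_smul, add_zero]
  · rw [min_eq_left (by omega), Finset.sum_range_succ, hS, hgl, Nat.add_sub_cancel]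
    congr 2
    ring

theorem lap_gP_rows (l : Ptn) :
    lap l.weight (gP l) = e' l • gP l + ∑ j ∈ Finset.range l.length, ∑ i ∈ Finset.range j,
      ∑ k ∈ Finset.range (l.row j), ((l.row i : F) - l.row j + 2 * (k + 1 : ℕ)) •
        gP (l.moveUp i j (k + 1)) := by
  have hpairs : ∀ i ∈ Finset.range l.length,
      ((l.parts.erase (l.row i)).map fun c : ℕ => ∑ d ∈ Finset.range (min (l.row i + 1) c),
        (α * ((l.row i : F) + c - 2 * d)) •
          gM ((l.row i + c - d) ::ₘ d ::ₘ (l.parts.erase (l.row i)).erase c)).sum =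
      ∑ j ∈ (Finset.range l.length).erase i,
        ∑ d ∈ Finset.range (min (l.row i + 1) (l.row j)),
          (α * ((l.row i : F) + l.row j - 2 * d)) •
            gM ((l.row i + l.row j - d) ::ₘ d ::ₘ l.restParts i j) := by
    intro i hi
    have h1 : l.parts.erase (l.row i) = ((Finset.range l.length).erase i).val.map l.row := by
      conv_lhs => rw [l.parts_eq_map_row]
      rw [Finset.erase_val, Multiset.map_erase_of_mem _ _ (Finset.mem_def.1 hi)]
    rw [h1, Multiset.map_map]
    refine congrArg Multiset.sum (Multiset.map_congr rfl fun j hj => ?_)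
    have h2 : (((Finset.range l.length).erase i).val.map l.row).erase (l.row j) =
        l.restParts i j := by
      rw [Ptn.restParts, Finset.erase_val (a := j), Multiset.map_erase_of_mem _ _ hj]
    rw [Function.comp_apply, h2]
  have h3 : vac l.weight 3 (gP l) = (2 * α) • (∑ j ∈ Finset.range l.length,
      ∑ i ∈ Finset.range j, ∑ k ∈ Finset.range (l.row j),
        ((l.row i : F) - l.row j + 2 * (k + 1 : ℕ)) • gP (l.moveUp i j (k + 1))) +
      (∑ t ∈ Finset.range l.length, (α * (l.row t : F)) ^ 2 +
        α * ∑ t ∈ Finset.range l.length, ((l.length : F) - 1 - 2 * t) * (l.row t : F) -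
        α * (l.weight : F) * (l.length : F)) • gP l := by
    have h := vac_three (N := l.weight) l.pos le_rfl
    have hg : gM l.parts = gP l := rfl
    rw [hg] at h
    rw [h, l.sum_map_parts, Finset.sum_add_distrib,
      Finset.sum_congr rfl hpairs, sum_erase_eq_sum_lt]
    have hc := Finset.sum_congr rfl fun j (hj : j ∈ Finset.range l.length) =>
      Finset.sum_congr rfl fun i (hi : i ∈ Finset.range j) =>
        pair_contribution l (Finset.mem_range.1 hi) (Finset.mem_range.1 hj)
    rw [hc]
    simp only [Finset.sum_add_distrib, ← Finset.smul_sum, ← Finset.sum_smul, ← Finset.mul_sum]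
    rw [sum_lt_sub, sub_smul, add_smul]
    rw [add_left_comm, add_sub_assoc]
    rfl
  have hw : (l.weight : F) = ∑ t ∈ Finset.range l.length, (l.row t : F) := by
    rw [l.weight_eq_sum_row le_rfl, Nat.cast_sum]
  rw [lap, LinearMap.sub_apply, LinearMap.smul_apply, h3, smul_add, smul_smul,
    inv_mul_cancel₀ (mul_ne_zero two_ne_zero α_ne_zero), one_smul, LinearMap.smul_apply,
    LinearMap.id_apply, add_sub_assoc, smul_smul, ← sub_smul, add_comm]
  congr 2
  -- The linear terms match because $(l-1-2t)/2-l/2-1/2=-(t+1)$; the last $1/2$ is the multiple of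
  -- the identity subtracted in `lap`.
  rw [e', hw]
  have hα := α_ne_zero
  field_simp
  simp only [Finset.mul_sum, ← Finset.sum_add_distrib, ← Finset.sum_sub_distrib]
  refine Finset.sum_congr rfl fun t _ => ?_
  ring

theorem sum_moves {M : Type*} [AddCommMonoid M] (l : Ptn) (G : ℕ → ℕ → ℕ → M) :
    ∑ j ∈ Finset.range l.length, ∑ i ∈ Finset.range j, ∑ k ∈ Finset.range (l.row j),
      G i j (k + 1) = ∑ t ∈ l.moves, G t.1 t.2.1 t.2.2 := by
  rw [Finset.sum_sigma', Finset.sum_sigma']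
  refine Finset.sum_bij' (fun x _ => (x.1.2, x.1.1, x.2 + 1))
    (fun t _ => ⟨⟨t.2.1, t.1⟩, t.2.2 - 1⟩) ?_ ?_ ?_ ?_ ?_
  · rintro ⟨⟨j, i⟩, k⟩ h
    simp only [Finset.mem_sigma, Finset.mem_range] at h
    exact Ptn.mem_moves.2 ⟨h.1.2, k.succ_pos, h.2⟩
  · rintro ⟨i, j, k⟩ h
    have h' := Ptn.mem_moves.1 h
    have h1 := h'.lt_length
    obtain ⟨h2, h3, h4⟩ := h'
    simp only [Finset.mem_sigma, Finset.mem_range] at h1 h2 h3 h4 ⊢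
    omega
  · rintro ⟨⟨j, i⟩, k⟩ _
    simp
  · rintro ⟨i, j, k⟩ h
    have := (Ptn.mem_moves.1 h).2.1
    simp only at this ⊢
    rw [Nat.sub_add_cancel this]
  · rintro ⟨⟨j, i⟩, k⟩ _
    rfl

theorem card_row_eq (l : Ptn) (x : ℕ) :
    ((Finset.range l.length).filter fun i => l.row i = x).card = l.mult x := by
  rw [Ptn.mult, l.parts_eq_map_row, Multiset.count_map, Finset.card_def, Finset.filter_val]
  congr 1
  exact Multiset.filter_congr fun i _ => eq_comm

theorem card_pairs_lt (I : Finset ℕ) :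
    2 * (((I ×ˢ I).filter fun p => p.1 < p.2).card : F) = (I.card : F) * ((I.card : F) - 1) := by
  have h1 : ((I ×ˢ I).filter fun p => p.2 < p.1).card =
      ((I ×ˢ I).filter fun p => p.1 < p.2).card := by
    refine Finset.card_bij' (fun p _ => p.swap) (fun p _ => p.swap) ?_ ?_ ?_ ?_ <;>
      simp +contextual [Finset.mem_filter]
  have h2 : I.offDiag = ((I ×ˢ I).filter fun p => p.1 < p.2) ∪
      ((I ×ˢ I).filter fun p => p.2 < p.1) := by
    ext p
    simp only [Finset.mem_offDiag, Finset.mem_union, Finset.mem_filter, Finset.mem_product]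
    have := Nat.lt_or_gt_of_ne (a := p.1) (b := p.2)
    constructor
    · rintro ⟨a, b, c⟩
      rcases this c with h | h
      · exact Or.inl ⟨⟨a, b⟩, h⟩
      · exact Or.inr ⟨⟨a, b⟩, h⟩
    · rintro (⟨⟨a, b⟩, h⟩ | ⟨⟨a, b⟩, h⟩)
      · exact ⟨a, b, h.ne⟩
      · exact ⟨a, b, h.ne'⟩
  have h3 : Disjoint ((I ×ˢ I).filter fun p => p.1 < p.2)
      ((I ×ˢ I).filter fun p => p.2 < p.1) :=
    Finset.disjoint_filter.2 fun p _ h h' => lt_asymm h h'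
  have h4 := Finset.offDiag_card I
  rw [h2, Finset.card_union_of_disjoint h3, h1] at h4
  have h5 : I.card ≤ I.card * I.card := Nat.le_mul_self _
  have h6 := congrArg (Nat.cast : ℕ → F) h4
  rw [Nat.cast_sub h5] at h6
  push_cast at h6
  rw [two_mul, h6]
  ring

/-- By `move_unique`, moves with the same image use the same `k` and rows of the same two lengths.
Different lengths leave a free choice of one row of each, since the order of the rows is then
automatic; equal lengths leave unordered pairs, whence the factor 1/2. -/
theorem card_fiber {l : Ptn} {t : ℕ × ℕ × ℕ} (ht : t ∈ l.moves) :
    ((l.moves.filter fun u => l.moveUp u.1 u.2.1 u.2.2 = l.moveUp t.1 t.2.1 t.2.2).card : F) =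
      (1 + if l.row t.1 = l.row t.2.1 then 1 else 0)⁻¹ * (l.mult (l.row t.1) : F) *
        ((l.mult (l.row t.2.1) : F) - if l.row t.1 = l.row t.2.1 then 1 else 0) := by
  obtain ⟨i, j, k⟩ := t
  have hm := Ptn.mem_moves.1 ht
  simp only at hm ⊢
  set I := (Finset.range l.length).filter fun a => l.row a = l.row i with hI
  set J := (Finset.range l.length).filter fun a => l.row a = l.row j with hJ
  have hcard : (l.moves.filter fun u => l.moveUp u.1 u.2.1 u.2.2 = l.moveUp i j k).card =
      ((I ×ˢ J).filter fun p => p.1 < p.2).card := by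
    refine Finset.card_bij' (fun u _ => (u.1, u.2.1)) (fun p _ => (p.1, p.2, k)) ?_ ?_ ?_ ?_
    · rintro ⟨i', j', k'⟩ hu
      rw [Finset.mem_filter, Ptn.mem_moves] at hu
      obtain ⟨h1, h2⟩ := hu
      obtain ⟨e1, e2, -⟩ := l.move_unique h1 hm h2
      have := h1.lt_length
      simp only [hI, hJ, Finset.mem_filter, Finset.mem_product, Finset.mem_range]
      exact ⟨⟨⟨this.1, e1⟩, this.2, e2⟩, h1.1⟩
    · rintro ⟨i', j'⟩ hp
      simp only [hI, hJ, Finset.mem_filter, Finset.mem_product, Finset.mem_range] at hp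
      have h1 : l.IsMove i' j' k := ⟨hp.2, hm.2.1, by rw [hp.1.2.2]; exact hm.2.2⟩
      rw [Finset.mem_filter, Ptn.mem_moves]
      exact ⟨h1, Ptn.moveUp_congr h1 hm hp.1.1.2 hp.1.2.2⟩
    · rintro ⟨i', j', k'⟩ hu
      rw [Finset.mem_filter, Ptn.mem_moves] at hu
      obtain rfl : k' = k := (l.move_unique hu.1 hm hu.2).2.2
      rfl
    · rintro ⟨i', j'⟩ _
      rfl
  rw [hcard, ← card_row_eq, ← card_row_eq, ← hI, ← hJ]
  split_ifs with h
  · have hIJ : J = I := by rw [hI, hJ, h]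
    rw [hIJ, mul_assoc, ← card_pairs_lt, one_add_one_eq_two, inv_mul_cancel_left₀ two_ne_zero]
  · rw [add_zero, inv_one, one_mul, sub_zero, ← Nat.cast_mul, ← Finset.card_product,
      Finset.filter_true_of_mem]
    rintro ⟨i', j'⟩ hp
    simp only [hI, hJ, Finset.mem_filter, Finset.mem_product, Finset.mem_range] at hp
    by_contra hlt
    have h1 := l.row_anti (not_lt.1 hlt)
    have h2 := l.row_antitone hm.1
    rw [hp.1.2, hp.2.2] at h1
    exact h (le_antisymm h1 h2)

/-- The action of the Laplace–Beltrami operator on the `g_λ`. -/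
theorem lap_gP (l : Ptn) :
    lap l.weight (gP l) = e' l • gP l + ∑ m ∈ l.upper, r l m • gP m := by
  rw [lap_gP_rows, sum_moves l fun i j k =>
    ((l.row i : F) - l.row j + 2 * (k : ℕ)) • gP (l.moveUp i j k)]
  congr 1
  rw [Ptn.upper, ← Finset.sum_fiberwise_of_maps_to (g := fun t => l.moveUp t.1 t.2.1 t.2.2)
    fun t ht => Finset.mem_image_of_mem (fun t : ℕ × ℕ × ℕ => l.moveUp t.1 t.2.1 t.2.2) ht]
  refine Finset.sum_congr rfl fun m hm => ?_
  obtain ⟨t, ht, rfl⟩ := Finset.mem_image.1 hm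
  rw [r_moveUp l _ _ _ (Ptn.mem_moves.1 ht), moveCoeff, ← card_fiber ht, mul_smul,
    Nat.cast_smul_eq_nsmul, ← Finset.sum_const]
  refine Finset.sum_congr rfl fun u hu => ?_
  rw [Finset.mem_filter] at hu
  obtain ⟨e1, e2, e3⟩ := l.move_unique (Ptn.mem_moves.1 hu.1) (Ptn.mem_moves.1 ht) hu.2
  rw [hu.2, e1, e2, e3]

/-! ### Triangularity of the vacuum operators -/

theorem Ptn.Maj.cons_zero (s : Multiset ℕ) : Maj (0 ::ₘ s) s ∧ Maj s (0 ::ₘ s) := by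
  constructor <;> constructor <;> simp

theorem Ptn.Maj.cons_pair {l s : Multiset ℕ} {a b d : ℕ} (h : Maj l (a ::ₘ s)) (hb : b ∈ s)
    (hd : d < min (a + 1) b) : Maj l ((a + b - d) ::ₘ d ::ₘ s.erase b) := by
  refine h.trans ?_
  have := maj_pair (a := a) (b := b) (d := d) (by omega) (by omega) (s.erase b)
  rwa [Multiset.cons_erase hb] at this

theorem Ptn.Maj.not_cons_pair {l s : Multiset ℕ} {a b d : ℕ} (h : ¬ Maj (a ::ₘ s) l)
    (hb : b ∈ s) (hd : d < min (a + 1) b) : ¬ Maj ((a + b - d) ::ₘ d ::ₘ s.erase b) l :=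
  fun h' => h (((Maj.refl _).cons_pair hb hd).trans h')

/-- The vectors above the partition `l` in the majorization order. -/
def above (l : Ptn) : Submodule F (ℕ → Sym) :=
  Submodule.span F {v | ∃ a s, v = hv a s ∧ Ptn.Maj l.parts (a ::ₘ s) ∧
    ¬ Ptn.Maj (a ::ₘ s) l.parts}

theorem hv_mem_above {l : Ptn} {a : ℕ} {s : Multiset ℕ} (h : Ptn.Maj l.parts (a ::ₘ s))
    (h' : ¬ Ptn.Maj (a ::ₘ s) l.parts) : hv a s ∈ above l :=
  Submodule.subset_span ⟨a, s, rfl, h, h'⟩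

/-- Every exchange in `lax_hv` either spreads two entries apart or swaps them, so it never descends
in the majorization order. -/
theorem lax_mem_above {l : Ptn} {v : ℕ → Sym} (hv' : v ∈ above l) :
    lax l.weight v ∈ above l := by
  induction hv' using Submodule.span_induction with
  | zero => rw [map_zero]; exact zero_mem _
  | add x y _ _ hx hy => rw [map_add]; exact add_mem hx hy
  | smul c x _ hx => rw [map_smul]; exact Submodule.smul_mem _ _ hx
  | mem x hx =>
    obtain ⟨a, s, rfl, h1, h2⟩ := hx
    have ha : a ≤ l.weight := by
      have := h1.1
      rw [Multiset.sum_cons] at this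
      exact (Nat.le_add_right _ _).trans this.ge
    rw [lax_hv ha]
    refine add_mem (Submodule.smul_mem _ _ (hv_mem_above h1 h2)) (multiset_sum_mem _ fun x hx => ?_)
    obtain ⟨b, hb, rfl⟩ := Multiset.mem_map.1 hx
    refine Submodule.sum_mem _ fun d hd => ?_
    rw [Finset.mem_range] at hd
    have h3 := h1.cons_pair hb hd
    have h4 := Ptn.Maj.not_cons_pair h2 hb hd
    refine sub_mem (hv_mem_above h3 h4) (hv_mem_above ?_ ?_)
    · rwa [Multiset.cons_swap]
    · rwa [Multiset.cons_swap]

/-- Integral combinations of vectors of shape `l` with coefficients of degree `< k` in `α`, up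
to vectors above `l`. -/
def lowDegree (l : Ptn) (k : ℕ) : AddSubgroup (ℕ → Sym) :=
  -- Only an additive subgroup in this first summand: a span over $\mathbb{Q}(\alpha)$ would lose
  -- the degree in `α`.
  AddSubgroup.closure {v | ∃ i < k, ∃ a s, a ::ₘ s = 0 ::ₘ l.parts ∧ v = α ^ i • hv a s} ⊔
    (above l).toAddSubgroup

theorem mem_lowDegree_of_mem_above {l : Ptn} {v : ℕ → Sym} (h : v ∈ above l) (k : ℕ) :
    v ∈ lowDegree l k :=
  AddSubgroup.mem_sup_right h

theorem pow_smul_hv_mem {l : Ptn} {i k : ℕ} (hi : i < k) {a : ℕ} {s : Multiset ℕ}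
    (h : a ::ₘ s = 0 ::ₘ l.parts) : α ^ i • hv a s ∈ lowDegree l k :=
  AddSubgroup.mem_sup_left (AddSubgroup.subset_closure ⟨i, hi, a, s, h, rfl⟩)

/-- In `lax_hv` the exchanges with `d < a` go strictly above `l`, and `d = a` merely swaps `a` and
`b` without a factor `α`. Hence the diagonal term `α a` alone raises the degree. -/
theorem pow_smul_lax_hv {l : Ptn} (i : ℕ) {a : ℕ} {s : Multiset ℕ}
    (h : a ::ₘ s = 0 ::ₘ l.parts) :
    α ^ i • lax l.weight (hv a s) - a • α ^ (i + 1) • hv a s ∈ lowDegree l (i + 1) := by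
  have ha : a ≤ l.weight := by
    have := congrArg Multiset.sum h
    rw [Multiset.sum_cons, Multiset.sum_cons, zero_add] at this
    exact (Nat.le_add_right _ _).trans this.le
  have h1 : Ptn.Maj l.parts (a ::ₘ s) := h ▸ (Ptn.Maj.cons_zero l.parts).2
  have h2 : Ptn.Maj (a ::ₘ s) l.parts := h ▸ (Ptn.Maj.cons_zero l.parts).1
  rw [lax_hv ha, smul_add, smul_smul, ← mul_assoc, ← pow_succ, mul_comm, mul_smul,
    Nat.cast_smul_eq_nsmul, add_sub_cancel_left, Multiset.smul_sum, Multiset.map_map]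
  refine multiset_sum_mem _ fun x hx => ?_
  obtain ⟨b, hb, rfl⟩ := Multiset.mem_map.1 hx
  rw [Function.comp_apply, Finset.smul_sum]
  refine AddSubgroup.sum_mem _ fun d hd => ?_
  rw [Finset.mem_range] at hd
  rw [smul_sub]
  rcases Nat.lt_or_ge d a with hda | hda
  · have h3 := h1.cons_pair hb hd
    have h4 : ¬ Ptn.Maj ((a + b - d) ::ₘ d ::ₘ s.erase b) l.parts := by
      have := Ptn.not_maj_pair hda (show d < b by omega) (s.erase b)
      rw [Multiset.cons_erase hb] at this
      exact fun h' => this (h'.trans h1)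
    refine mem_lowDegree_of_mem_above (sub_mem (Submodule.smul_mem _ _ (hv_mem_above h3 h4))
      (Submodule.smul_mem _ _ (hv_mem_above ?_ ?_))) _
    · rwa [Multiset.cons_swap]
    · rwa [Multiset.cons_swap]
  · obtain rfl : d = a := by omega
    rw [Nat.add_sub_cancel_left]
    refine sub_mem (pow_smul_hv_mem i.lt_succ_self ?_) (pow_smul_hv_mem i.lt_succ_self ?_)
    · rw [Multiset.cons_swap, Multiset.cons_erase hb, h]
    · rw [Multiset.cons_erase hb, h]

theorem lowDegree_mono (l : Ptn) {i j : ℕ} (h : i ≤ j) : lowDegree l i ≤ lowDegree l j := by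
  refine sup_le_sup_right (AddSubgroup.closure_mono ?_) _
  rintro v ⟨k, hk, h'⟩
  exact ⟨k, hk.trans_le h, h'⟩

theorem lax_mem_lowDegree {l : Ptn} {k : ℕ} {v : ℕ → Sym} (h : v ∈ lowDegree l k) :
    lax l.weight v ∈ lowDegree l (k + 1) := by
  obtain ⟨y, hy, z, hz, rfl⟩ := AddSubgroup.mem_sup.1 h
  rw [map_add]
  refine add_mem ?_ (mem_lowDegree_of_mem_above (lax_mem_above hz) _)
  clear h
  induction hy using AddSubgroup.closure_induction with
  | zero => rw [map_zero]; exact zero_mem _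
  | add x y _ _ hx hy =>
    rw [map_add]
    exact add_mem hx hy
  | neg x _ hx => rw [map_neg]; exact neg_mem hx
  | mem x hx =>
    obtain ⟨i, hi, a, s, has, rfl⟩ := hx
    have h1 := lowDegree_mono l (show i + 1 ≤ k + 1 by omega) (pow_smul_lax_hv i has)
    have h2 : a • α ^ (i + 1) • hv a s ∈ lowDegree l (k + 1) :=
      AddSubgroup.nsmul_mem _ (pow_smul_hv_mem (by omega) has) a
    rw [map_smul]
    simpa using add_mem h1 h2

theorem lax_pow_hv {l : Ptn} (j : ℕ) {a : ℕ} {s : Multiset ℕ} (h : a ::ₘ s = 0 ::ₘ l.parts) :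
    (lax l.weight ^ j) (hv a s) - a ^ j • α ^ j • hv a s ∈ lowDegree l j := by
  induction j with
  | zero => simp [zero_mem]
  | succ j ih =>
    have h1 := lax_mem_lowDegree ih
    have h2 := AddSubgroup.nsmul_mem _ (pow_smul_lax_hv j h) (a ^ j)
    rw [map_sub, map_nsmul, map_smul] at h1
    rw [smul_sub, smul_smul, ← pow_succ] at h2
    rw [pow_succ', Module.End.mul_apply]
    simpa using add_mem h1 h2

/-- The functions above `l` in the dominance order. -/
def upSpan (l : Ptn) : Submodule F Sym := Submodule.span F {f | ∃ m, l.StrictDom m ∧ f = gP m}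

theorem above_apply_zero {l : Ptn} {v : ℕ → Sym} (h : v ∈ above l) : v 0 ∈ upSpan l := by
  induction h using Submodule.span_induction with
  | zero => exact zero_mem _
  | add x y _ _ hx hy => exact add_mem hx hy
  | smul c x _ hx => exact Submodule.smul_mem _ _ hx
  | mem x hx =>
    obtain ⟨a, s, rfl, h1, h2⟩ := hx
    rw [hv_apply_zero, ← gP_ofMultiset]
    exact Submodule.subset_span ⟨_, Ptn.strictDom_of_maj h1 h2, rfl⟩

theorem lowDegree_apply_zero {l : Ptn} {k : ℕ} {v : ℕ → Sym} (h : v ∈ lowDegree l k) :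
    ∃ q : Polynomial ℚ, q.degree < k ∧ v 0 - algebraMap (Polynomial ℚ) F q • gP l ∈ upSpan l := by
  obtain ⟨y, hy, z, hz, rfl⟩ := AddSubgroup.mem_sup.1 h
  have key : ∃ q : Polynomial ℚ, q.degree < k ∧
      y 0 - algebraMap (Polynomial ℚ) F q • gP l = 0 := by
    clear h
    induction hy using AddSubgroup.closure_induction with
    | zero => exact ⟨0, by simp, by simp⟩
    | add x y _ _ hx hy =>
      obtain ⟨q, hq, hq'⟩ := hx
      obtain ⟨p, hp, hp'⟩ := hy
      refine ⟨q + p, (Polynomial.degree_add_le _ _).trans_lt (max_lt hq hp), ?_⟩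
      rw [map_add, add_smul, Pi.add_apply, add_sub_add_comm, hq', hp', add_zero]
    | neg x _ hx =>
      obtain ⟨q, hq, hq'⟩ := hx
      refine ⟨-q, by rwa [Polynomial.degree_neg], ?_⟩
      rw [map_neg, neg_smul, Pi.neg_apply, ← neg_sub', hq', neg_zero]
    | mem x hx =>
      obtain ⟨i, hi, a, s, has, rfl⟩ := hx
      refine ⟨Polynomial.X ^ i, ?_, ?_⟩
      · rw [Polynomial.degree_X_pow]
        exact_mod_cast hi
      · rw [map_pow, RatFunc.algebraMap_X, Pi.smul_apply, hv_apply_zero, has, gM_cons, g_zero,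
          one_mul]
        exact sub_self _
  obtain ⟨q, hq, hq'⟩ := key
  refine ⟨q, hq, ?_⟩
  rw [Pi.add_apply, add_sub_right_comm, hq', zero_add]
  exact above_apply_zero hz

/-- Leading behaviour of the vacuum operators on the `g_λ`. -/
theorem vac_gP (l : Ptn) {j : ℕ} (hj : 0 < j) :
    ∃ q : Polynomial ℚ, q.degree < j ∧ vac l.weight (j + 1) (gP l) -
      algebraMap (Polynomial ℚ) F
        (Polynomial.C (((l.parts.map (· ^ j)).sum : ℕ) : ℚ) * Polynomial.X ^ j + q) • gP l ∈
      upSpan l := by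
  have h0 := lax_pow_hv (l := l) j (a := 0) (s := l.parts) rfl
  -- For `j > 0` the vector with distinguished entry 0 has no leading term, so the `- hv 0 s` of
  -- `lax_single` does not affect the coefficient of `α ^ j`.
  rw [zero_pow hj.ne', zero_smul, sub_zero] at h0
  have h1 : (lax l.weight ^ (j + 1)) (hv 0 l.parts) -
      (l.parts.map fun b => b ^ j • α ^ j • hv b (l.parts.erase b)).sum ∈ lowDegree l j := by
    rw [pow_succ, Module.End.mul_apply, lax_single l.pos, map_multiset_sum, Multiset.map_map,
      ← Multiset.sum_map_sub]
    refine multiset_sum_mem _ fun x hx => ?_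
    obtain ⟨b, hb, rfl⟩ := Multiset.mem_map.1 hx
    rw [Function.comp_apply, map_sub, sub_right_comm]
    refine sub_mem ?_ h0
    rw [← hv_cons_zero]
    exact lax_pow_hv j (by rw [Multiset.cons_swap, Multiset.cons_erase hb])
  obtain ⟨q, hq, hq'⟩ := lowDegree_apply_zero h1
  refine ⟨q, hq, ?_⟩
  have hev : ∀ (S : Multiset (ℕ → Sym)), S.sum 0 = (S.map fun f => f 0).sum := fun S =>
    map_multiset_sum (Pi.evalAddMonoidHom (fun _ : ℕ => Sym) 0) S
  have h2 : (l.parts.map fun b => b ^ j • α ^ j • hv b (l.parts.erase b)).sum 0 =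
      algebraMap (Polynomial ℚ) F
        (Polynomial.C (((l.parts.map (· ^ j)).sum : ℕ) : ℚ) * Polynomial.X ^ j) • gP l := by
    rw [hev, Multiset.map_map, map_mul, map_pow, RatFunc.algebraMap_X, RatFunc.algebraMap_C,
      map_natCast, mul_smul, Nat.cast_smul_eq_nsmul, Multiset.sum_smul, Multiset.map_map]
    refine congrArg Multiset.sum (Multiset.map_congr rfl fun b hb => ?_)
    rw [Function.comp_apply, Pi.smul_apply, Pi.smul_apply, hv_apply_zero, Multiset.cons_erase hb]
    rfl
  rw [vac_apply, map_add, add_smul, ← h2, ← sub_sub]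
  rw [hv_zero] at hq'
  exact hq'

/-! ### Separation of partitions by power sums -/

/-- Bernoulli's inequality $(1+1/x)^j\ge 1+j/x$ with denominators cleared. -/
theorem mul_succ_pow_ge (x j : ℕ) : x ^ j * (x + j) ≤ x * (x + 1) ^ j := by
  induction j with
  | zero => simp
  | succ j ih =>
    calc x ^ (j + 1) * (x + (j + 1)) ≤ (x ^ j * (x + j)) * (x + 1) := by
          rw [pow_succ]; nlinarith [Nat.zero_le (x ^ j * j)]
      _ ≤ x * (x + 1) ^ j * (x + 1) := Nat.mul_le_mul_right _ ih
      _ = x * (x + 1) ^ (j + 1) := by ring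

theorem mul_pred_pow_lt {a n j : ℕ} (ha : 0 < a) (han : a ≤ n) (hj : n * n < j) :
    n * (a - 1) ^ j < a ^ j := by
  obtain ⟨x, rfl⟩ : ∃ x, a = x + 1 := ⟨a - 1, by omega⟩
  rw [Nat.add_sub_cancel]
  rcases Nat.eq_zero_or_pos x with rfl | hx
  · rw [zero_pow (by omega)]
    simp
  · refine Nat.lt_of_mul_lt_mul_left (a := x) ((?_ : _ < _).trans_le (mul_succ_pow_ge x j))
    have h1 : n * x < x + j := by nlinarith
    calc x * (n * x ^ j) = x ^ j * (n * x) := by ring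
      _ < x ^ j * (x + j) := Nat.mul_lt_mul_of_pos_left h1 (pow_pos hx j)

/-- At most `n` terms, each at most $(a-1)^j$, cannot reach $a^j$ once $j>n^2$. -/
theorem sum_pow_lt {s t : Multiset ℕ} {a n j : ℕ} (hs : a ∈ s) (ht : ∀ b ∈ t, b < a)
    (ha : 0 < a) (han : a ≤ n) (htn : t.card ≤ n) (hj : n * n < j) :
    (t.map (· ^ j)).sum < (s.map (· ^ j)).sum := by
  calc (t.map (· ^ j)).sum ≤ (t.map (· ^ j)).card • (a - 1) ^ j := by
        refine Multiset.sum_le_card_nsmul _ _ fun x hx => ?_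
        obtain ⟨b, hb, rfl⟩ := Multiset.mem_map.1 hx
        have := ht b hb
        exact Nat.pow_le_pow_left (by omega) _
    _ ≤ n * (a - 1) ^ j := by
        rw [Multiset.card_map, smul_eq_mul]
        exact Nat.mul_le_mul_right _ htn
    _ < a ^ j := mul_pred_pow_lt ha han hj
    _ ≤ (s.map (· ^ j)).sum :=
        Multiset.single_le_sum (fun _ _ => Nat.zero_le _) _ (Multiset.mem_map_of_mem _ hs)

/-- After the common parts are cancelled, the largest remaining part occurs on one side only, and
its power alone outweighs the other side. -/
theorem eq_of_sum_pow_eq {l m : Ptn} {n j : ℕ} (hl : l.weight = n) (hm : m.weight = n)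
    (hj : n * n < j) (h : (l.parts.map (· ^ j)).sum = (m.parts.map (· ^ j)).sum) : l = m := by
  by_contra hne
  set s := l.parts - m.parts with hs
  set t := m.parts - l.parts with ht
  have hls : l.parts = s + l.parts ∩ m.parts := (Multiset.sub_add_inter _ _).symm
  have hmt : m.parts = t + l.parts ∩ m.parts := by
    rw [Multiset.inter_comm]; exact (Multiset.sub_add_inter _ _).symm
  have hpow : (s.map (· ^ j)).sum = (t.map (· ^ j)).sum := by
    have h1 := congrArg (fun u => (Multiset.map (· ^ j) u).sum) hls
    have h2 := congrArg (fun u => (Multiset.map (· ^ j) u).sum) hmt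
    simp only [Multiset.map_add, Multiset.sum_add] at h1 h2
    omega
  have hsl : s ≤ l.parts := Multiset.sub_le_self _ _
  have htm : t ≤ m.parts := Multiset.sub_le_self _ _
  have hdisj : ∀ a ∈ s, a ∉ t := by
    intro a has hat
    have h1 := Multiset.count_pos.2 has
    have h2 := Multiset.count_pos.2 hat
    rw [hs, Multiset.count_sub] at h1
    rw [ht, Multiset.count_sub] at h2
    omega
  have hst : s + t ≠ 0 := by
    intro h0
    have h1 : s = 0 := Multiset.le_zero.1 (h0 ▸ Multiset.le_add_right s t)
    have h2 : t = 0 := Multiset.le_zero.1 (h0 ▸ Multiset.le_add_left t s)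
    refine hne (Ptn.ext ?_)
    rw [h1, zero_add] at hls
    rw [h2, zero_add] at hmt
    exact hls.trans hmt.symm
  obtain ⟨b₀, hb₀⟩ := Multiset.exists_mem_of_ne_zero hst
  obtain ⟨a, ha, hmax⟩ := (s + t).toFinset.exists_max_image id ⟨b₀, Multiset.mem_toFinset.2 hb₀⟩
  rw [Multiset.mem_toFinset] at ha
  have hmax' : ∀ b ∈ s + t, b ≤ a := fun b hb => hmax b (Multiset.mem_toFinset.2 hb)
  have hbound : ∀ k : Ptn, k.weight = n → ∀ b ∈ k.parts, 0 < b ∧ b ≤ n := fun k hk b hb =>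
    ⟨k.pos b hb, hk ▸ Multiset.single_le_sum (fun _ _ => Nat.zero_le _) b hb⟩
  rcases Multiset.mem_add.1 ha with has | hat
  · obtain ⟨h1, h2⟩ := hbound l hl a (Multiset.mem_of_le hsl has)
    refine (sum_pow_lt has (fun b hb => ?_) h1 h2 ?_ hj).ne' hpow
    · refine lt_of_le_of_ne (hmax' b (Multiset.mem_add.2 (Or.inr hb))) ?_
      rintro rfl
      exact hdisj _ has hb
    · exact (Multiset.card_le_card htm).trans (hm ▸ m.length_le_weight)
  · obtain ⟨h1, h2⟩ := hbound m hm a (Multiset.mem_of_le htm hat)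
    refine (sum_pow_lt hat (fun b hb => ?_) h1 h2 ?_ hj).ne hpow
    · refine lt_of_le_of_ne (hmax' b (Multiset.mem_add.2 (Or.inl hb))) ?_
      rintro rfl
      exact hdisj _ hb hat
    · exact (Multiset.card_le_card hsl).trans (hl ▸ l.length_le_weight)

/-- A self-adjoint operator that is triangular in degree `n` with diagonal entries `ε`. -/
def IsTri (n : ℕ) (E : Sym →ₗ[F] Sym) (ε : Ptn → F) : Prop :=
  (∀ f h, form (E f) h = form f (E h)) ∧
    ∀ l : Ptn, l.weight = n → E (gP l) - ε l • gP l ∈ upSpan l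

theorem isTri_lap (n : ℕ) : IsTri n (lap n) e' := by
  refine ⟨form_lap n, ?_⟩
  rintro l rfl
  rw [lap_gP, add_sub_cancel_left]
  exact Submodule.sum_mem _ fun m hm => Submodule.smul_mem _ _
    (Submodule.subset_span ⟨m, Ptn.strictDom_of_mem_upper hm, rfl⟩)

/-- The eigenvalues are polynomials in `α` whose coefficient at $\alpha^{n^2+1}$ is the power sum of
the parts, so equal eigenvalues force equal partitions, comparable or not. -/
theorem exists_separating (n : ℕ) : ∃ E ε, IsTri n E ε ∧
    ∀ l m : Ptn, l.weight = n → m.weight = n → ε l = ε m → l = m := by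
  choose q hq hq' using fun l : Ptn => vac_gP l (j := n * n + 1) (Nat.succ_pos _)
  refine ⟨vac n (n * n + 1 + 1), fun l => algebraMap (Polynomial ℚ) F
    (Polynomial.C (((l.parts.map (· ^ (n * n + 1))).sum : ℕ) : ℚ) * Polynomial.X ^ (n * n + 1) +
      q l), ⟨form_vac _ _, ?_⟩, ?_⟩
  · rintro l rfl
    exact hq' l
  · intro l m hl hm h
    have h1 := congrArg (Polynomial.coeff · (n * n + 1)) (RatFunc.algebraMap_injective ℚ h)
    simp only [Polynomial.coeff_add, Polynomial.coeff_C_mul, Polynomial.coeff_X_pow_self, mul_one,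
      Polynomial.coeff_eq_zero_of_degree_lt (hq l), Polynomial.coeff_eq_zero_of_degree_lt (hq m),
      add_zero] at h1
    exact eq_of_sum_pow_eq hl hm (Nat.lt_succ_self _) (Nat.cast_injective h1)

/-! ### Triangular self-adjoint operators -/

/-- The span of the `m_μ` with `μ` strictly dominated by `l`. -/
def lowSpan (l : Ptn) : Submodule F Sym := Submodule.span F (mP '' {m | m.StrictDom l})

theorem mP_mem_lowSpan {l m : Ptn} (h : m.StrictDom l) : mP m ∈ lowSpan l :=
  Submodule.subset_span ⟨m, h, rfl⟩

theorem lowSpan_mono {l m : Ptn} (h : l.Dominated m) : lowSpan l ≤ lowSpan m :=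
  Submodule.span_mono (Set.image_mono fun _ hk => hk.trans_right h)

theorem lowSpan_le_homog (l : Ptn) : lowSpan l ≤ homog l.weight := by
  refine Submodule.span_le.2 ?_
  rintro _ ⟨m, hm, rfl⟩
  rw [← hm.1.1]
  exact mP_mem_homog m

theorem upSpan_le_homog (l : Ptn) : upSpan l ≤ homog l.weight := by
  refine Submodule.span_le.2 ?_
  rintro _ ⟨m, hm, rfl⟩
  rw [hm.1.1]
  exact gP_mem_homog m

theorem form_eq_zero_of_mem_upSpan {l : Ptn} {f h : Sym} (hf : f ∈ upSpan l)
    (H : ∀ m, l.StrictDom m → form (gP m) h = 0) : form f h = 0 := by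
  induction hf using Submodule.span_induction with
  | zero => rw [map_zero, LinearMap.zero_apply]
  | add x y _ _ hx hy => rw [map_add, LinearMap.add_apply, hx, hy, add_zero]
  | smul c x _ hx => rw [map_smul, LinearMap.smul_apply, hx, smul_zero]
  | mem x hx =>
    obtain ⟨m, hm, rfl⟩ := hx
    exact H m hm

theorem form_eq_zero_of_mem_lowSpan {l : Ptn} {f h : Sym} (hf : f ∈ lowSpan l)
    (H : ∀ m, m.StrictDom l → form h (mP m) = 0) : form h f = 0 := by
  induction hf using Submodule.span_induction with
  | zero => rw [map_zero]
  | add x y _ _ hx hy => rw [map_add, hx, hy, add_zero]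
  | smul c x _ hx => rw [map_smul, hx, smul_zero]
  | mem x hx =>
    obtain ⟨m, hm, rfl⟩ := hx
    exact H m hm

theorem form_gP_eq_zero_of_mem_lowSpan {k l : Ptn} {f : Sym} (hf : f ∈ lowSpan l)
    (h : ¬ k.StrictDom l) : form (gP k) f = 0 :=
  form_eq_zero_of_mem_lowSpan hf fun m hm => by
    rw [form_gP_mP, if_neg]
    rintro rfl
    exact h hm

theorem IsTri.mem_homog {n : ℕ} {E : Sym →ₗ[F] Sym} {ε : Ptn → F} (hE : IsTri n E ε) {f : Sym}
    (hf : f ∈ homog n) : E f ∈ homog n := by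
  rw [eq_sum_gP hf, map_sum]
  refine Submodule.sum_mem _ fun l hl => ?_
  have hl' := mem_ptns.1 hl
  rw [map_smul, ← sub_add_cancel (E (gP l)) (ε l • gP l)]
  refine Submodule.smul_mem _ _ (add_mem ?_ (Submodule.smul_mem _ _ ?_))
  · have := upSpan_le_homog l (hE.2 l hl')
    rwa [hl'] at this
  · exact hl' ▸ gP_mem_homog l

/-- Duality: the matrix of a self-adjoint operator on the $m_\lambda$ is the transpose of its matrix
on the $g_\lambda$, so upward triangularity becomes downward triangularity. -/
theorem IsTri.apply_mP_sub_mem {n : ℕ} {E : Sym →ₗ[F] Sym} {ε : Ptn → F} (hE : IsTri n E ε) {l : Ptn}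
    (hl : l.weight = n) : E (mP l) - ε l • mP l ∈ lowSpan l := by
  have hm : mP l ∈ homog n := hl ▸ mP_mem_homog l
  have hh : E (mP l) - ε l • mP l ∈ homog n :=
    sub_mem (hE.mem_homog hm) (Submodule.smul_mem _ _ hm)
  rw [eq_sum_mP hh]
  refine Submodule.sum_mem _ fun k hk => ?_
  by_cases hkl : k.StrictDom l
  · exact Submodule.smul_mem _ _ (mP_mem_lowSpan hkl)
  · have h1 : form (E (gP k) - ε k • gP k) (mP l) = 0 := by
      refine form_eq_zero_of_mem_upSpan (hE.2 k (mem_ptns.1 hk)) fun m hkm => ?_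
      rw [form_gP_mP, if_neg]
      rintro rfl
      exact hkl hkm
    have h2 : form (gP k) (E (mP l) - ε l • mP l) = 0 := by
      rw [map_sub, LinearMap.sub_apply, map_smul, LinearMap.smul_apply, sub_eq_zero] at h1
      rw [map_sub, ← hE.1, map_smul, h1, form_gP_mP]
      split_ifs with h
      · rw [h, sub_self]
      · rw [smul_zero, smul_zero, sub_zero]
    rw [h2, zero_smul]
    exact zero_mem _

theorem IsTri.mem_lowSpan {n : ℕ} {E : Sym →ₗ[F] Sym} {ε : Ptn → F} (hE : IsTri n E ε) {l : Ptn}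
    (hl : l.weight = n) {f : Sym} (hf : f ∈ lowSpan l) : E f ∈ lowSpan l := by
  induction hf using Submodule.span_induction with
  | zero => rw [map_zero]; exact zero_mem _
  | add x y _ _ hx hy => rw [map_add]; exact add_mem hx hy
  | smul c x _ hx => rw [map_smul]; exact Submodule.smul_mem _ _ hx
  | mem x hx =>
    obtain ⟨m, hm, rfl⟩ := hx
    have h1 := lowSpan_mono hm.1 (hE.apply_mP_sub_mem (hm.1.1.trans hl))
    rw [← sub_add_cancel (E (mP m)) (ε m • mP m)]
    exact add_mem h1 (Submodule.smul_mem _ _ (mP_mem_lowSpan hm))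

/-! ### Existence of the Jack functions -/

theorem finite_strictDom (l : Ptn) : {m : Ptn | m.StrictDom l}.Finite :=
  (ptns l.weight).finite_toSet.subset fun _ hm => mem_ptns.2 hm.1.1

/-- The operator $E-\varepsilon_l$ maps the finite-dimensional `lowSpan l` to itself with nonzero
diagonal entries, hence bijectively; inverting it there corrects $m_l$ to an eigenvector. -/
theorem exists_eigenvector {n : ℕ} {E : Sym →ₗ[F] Sym} {ε : Ptn → F} (hE : IsTri n E ε) {l : Ptn}
    (hl : l.weight = n) (hsep : ∀ m : Ptn, m.StrictDom l → ε m ≠ ε l) :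
    ∃ P, P - mP l ∈ lowSpan l ∧ E P = ε l • P := by
  have hmaps : ∀ f ∈ lowSpan l, (E - ε l • (LinearMap.id : Sym →ₗ[F] Sym)) f ∈ lowSpan l := fun f hf =>
    sub_mem (hE.mem_lowSpan hl hf) (Submodule.smul_mem _ _ hf)
  set A : lowSpan l →ₗ[F] lowSpan l := (E - ε l • (LinearMap.id : Sym →ₗ[F] Sym)).restrict hmaps with hA
  have : FiniteDimensional F (lowSpan l) :=
    FiniteDimensional.span_of_finite F ((finite_strictDom l).image _)
  have hinj : Function.Injective A := by
    rw [← LinearMap.ker_eq_bot, LinearMap.ker_eq_bot']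
    rintro ⟨f, hf⟩ hAf
    have hf' : E f = ε l • f := sub_eq_zero.1 (congrArg Subtype.val hAf)
    -- For `f` in the kernel, the coefficients of the $m_k$ in `f` vanish from the top of the order
    -- downwards: once those above `k` are zero, self-adjointness leaves
    -- $(\varepsilon_k-\varepsilon_l)\langle g_k,f\rangle=0$.
    refine Subtype.ext (eq_of_form_gP fun k => ?_)
    change form (gP k) f = form (gP k) 0
    rw [map_zero]
    induction k using Ptn.dominance_induction_down with
    | H k ih =>
      by_cases hk : k.StrictDom l
      · have h1 := form_eq_zero_of_mem_upSpan (hE.2 k (hk.1.1.trans hl)) ih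
        rw [map_sub, LinearMap.sub_apply, hE.1, hf', map_smul, map_smul, LinearMap.smul_apply,
          ← sub_smul] at h1
        exact (smul_eq_zero.1 h1).resolve_left (sub_ne_zero.2 (hsep k hk).symm)
      · exact form_gP_eq_zero_of_mem_lowSpan hf hk
  obtain ⟨⟨u, hu⟩, hu'⟩ := LinearMap.surjective_of_injective hinj
    (-⟨E (mP l) - ε l • mP l, hE.apply_mP_sub_mem hl⟩)
  have h2 : E u - ε l • u = -(E (mP l) - ε l • mP l) := congrArg Subtype.val hu'
  refine ⟨mP l + u, by rwa [add_sub_cancel_left], ?_⟩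
  rw [map_add, smul_add, ← sub_eq_zero]
  have h3 : E (mP l) + E u - (ε l • mP l + ε l • u) =
      (E u - ε l • u) + (E (mP l) - ε l • mP l) := by abel
  rw [h3, h2, neg_add_cancel]

theorem isJackFamily_iff {P : Ptn → Sym} : IsJackFamily P ↔
    (∀ l, P l - mP l ∈ lowSpan l) ∧ ∀ l m, l ≠ m → form (P l) (P m) = 0 := by
  refine and_congr (forall_congr' fun l => ?_) Iff.rfl
  have hser : ∀ c : Ptn →₀ F, toSeries (Finsupp.linearCombination F mP c) =
      c.sum fun m a => a • monomialSeries m := by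
    intro c
    rw [Finsupp.linearCombination_apply, Finsupp.sum, map_sum, Finsupp.sum]
    exact Finset.sum_congr rfl fun m _ => by rw [map_smul, toSeries_mP]
  have hsingle : Finsupp.linearCombination F mP (Finsupp.single l 1) = mP l := by
    rw [Finsupp.linearCombination_single, one_smul]
  constructor
  · rintro ⟨c, hc, hcl, h⟩
    rw [← hser] at h
    rw [toSeries_injective h, ← hsingle, ← map_sub, lowSpan,
      Finsupp.mem_span_image_iff_linearCombination]
    refine ⟨_, ?_, rfl⟩
    rw [Finsupp.mem_supported]
    intro m hm
    rw [Finset.mem_coe, Finsupp.mem_support_iff, Finsupp.sub_apply] at hm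
    have hml : m ≠ l := by
      rintro rfl
      rw [hcl, Finsupp.single_eq_same, sub_self] at hm
      exact hm rfl
    rw [Finsupp.single_eq_of_ne hml, sub_zero] at hm
    exact ⟨hc m (Finsupp.mem_support_iff.2 hm), hml⟩
  · intro h
    rw [lowSpan, Finsupp.mem_span_image_iff_linearCombination] at h
    obtain ⟨c, hc, hc'⟩ := h
    rw [Finsupp.mem_supported] at hc
    refine ⟨c + Finsupp.single l 1, ?_, ?_, ?_⟩
    · intro m hm
      rcases Finset.mem_union.1 (Finsupp.support_add hm) with h1 | h1
      · exact (hc h1).1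
      · rw [Finset.mem_singleton.1 (Finsupp.support_single_subset h1)]
        exact Ptn.Dominated.refl l
    · have : c l = 0 := by
        by_contra h0
        exact (hc (Finsupp.mem_support_iff.2 h0)).2 rfl
      rw [Finsupp.add_apply, this, Finsupp.single_eq_same, zero_add]
    · rw [← hser, map_add, hc', hsingle, sub_add_cancel]

/-- Eigenvectors of a self-adjoint operator with separated eigenvalues are orthogonal within a
degree; different degrees are orthogonal by homogeneity. -/
theorem exists_isJackFamily : ∃ P, IsJackFamily P := by
  choose E ε hE hsep using exists_separating
  choose P hP hEP using fun l : Ptn => exists_eigenvector (hE l.weight) (l := l) rfl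
    fun m hm h => hm.2 (hsep _ m l hm.1.1 rfl h)
  refine ⟨P, isJackFamily_iff.2 ⟨hP, fun l m hlm => ?_⟩⟩
  have hom : ∀ l, P l ∈ homog l.weight := by
    intro l
    rw [← sub_add_cancel (P l) (mP l)]
    exact add_mem (lowSpan_le_homog l (hP l)) (mP_mem_homog l)
  by_cases hw : l.weight = m.weight
  · have h1 := (hE l.weight).1 (P l) (P m)
    have h2 := hEP m
    rw [← hw] at h2
    rw [hEP, h2, map_smul, map_smul, LinearMap.smul_apply, ← sub_eq_zero, ← sub_smul] at h1
    exact (smul_eq_zero.1 h1).resolve_left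
      (sub_ne_zero.2 fun h => hlm (hsep _ l m rfl hw.symm h))
  · exact form_eq_zero_of_homog hw (hom l) (hom m)

theorem isJackFamily_jackP : IsJackFamily jackP := by
  rw [jackP, dif_pos exists_isJackFamily]
  exact exists_isJackFamily.choose_spec

/-! ### Properties of the Jack functions -/

theorem jackP_sub_mem (l : Ptn) : jackP l - mP l ∈ lowSpan l :=
  (isJackFamily_iff.1 isJackFamily_jackP).1 l

theorem form_jackP {l m : Ptn} (h : l ≠ m) : form (jackP l) (jackP m) = 0 :=
  (isJackFamily_iff.1 isJackFamily_jackP).2 l m h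

theorem mP_mem_span_jackP (l : Ptn) :
    mP l ∈ Submodule.span F (jackP '' {m | m.Dominated l}) := by
  induction l using Ptn.dominance_induction with
  | H l ih =>
    rw [← sub_sub_cancel (jackP l) (mP l)]
    refine sub_mem (Submodule.subset_span ⟨l, Ptn.Dominated.refl l, rfl⟩) ?_
    refine (Submodule.span_le.2 ?_ : lowSpan l ≤ _) (jackP_sub_mem l)
    rintro _ ⟨m, hm, rfl⟩
    exact Submodule.span_mono (Set.image_mono fun k hk => hk.trans hm.1) (ih m hm)

theorem form_mP_eq_zero {f : Sym} {l : Ptn}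
    (H : ∀ k : Ptn, k.Dominated l → form f (jackP k) = 0) : form f (mP l) = 0 := by
  have : Submodule.span F (jackP '' {m | m.Dominated l}) ≤ LinearMap.ker (form f) := by
    refine Submodule.span_le.2 ?_
    rintro _ ⟨m, hm, rfl⟩
    exact H m hm
  exact this (mP_mem_span_jackP l)

theorem eq_of_form_jackP {f h : Sym} (H : ∀ l, form f (jackP l) = form h (jackP l)) : f = h := by
  refine eq_of_form_mP fun l => ?_
  rw [← sub_eq_zero, ← LinearMap.sub_apply, ← map_sub]
  refine form_mP_eq_zero fun k _ => ?_
  rw [map_sub, LinearMap.sub_apply, H, sub_self]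

theorem form_jackP_mP {l m : Ptn} (h : ¬ l.Dominated m) : form (jackP l) (mP m) = 0 :=
  form_mP_eq_zero fun k hk => form_jackP (by rintro rfl; exact h hk)

theorem form_jackP_of_mem_lowSpan {l m : Ptn} {f : Sym} (hf : f ∈ lowSpan m)
    (h : ¬ l.StrictDom m) : form (jackP l) f = 0 :=
  form_eq_zero_of_mem_lowSpan hf fun _ hk => form_jackP_mP fun hlk => h (hk.trans_left hlk)

theorem form_gP_jackP_self (l : Ptn) : form (gP l) (jackP l) = 1 := by
  rw [← sub_add_cancel (jackP l) (mP l), map_add, form_gP_mP, if_pos rfl,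
    form_gP_eq_zero_of_mem_lowSpan (jackP_sub_mem l) fun h => h.2 rfl, zero_add]

theorem form_gP_jackP {l m : Ptn} (h : ¬ l.Dominated m) : form (gP l) (jackP m) = 0 := by
  rw [← sub_add_cancel (jackP m) (mP m), map_add, form_gP_mP, if_neg,
    form_gP_eq_zero_of_mem_lowSpan (jackP_sub_mem m) fun h' => h h'.1, zero_add]
  rintro rfl
  exact h (Ptn.Dominated.refl l)

/-- Positivity is not needed: a vanishing norm would make $P_l$ orthogonal to every Jack function,
hence zero, against its leading coefficient 1. -/
theorem form_jackP_self_ne_zero (l : Ptn) : form (jackP l) (jackP l) ≠ 0 := by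
  intro h
  have h0 : jackP l = 0 := by
    refine eq_of_form_jackP fun m => ?_
    rw [map_zero, LinearMap.zero_apply]
    by_cases hlm : l = m
    · rwa [← hlm]
    · exact form_jackP hlm
  have := form_gP_jackP_self l
  rw [h0, map_zero] at this
  exact zero_ne_one this

/-- The vector $EP_l-\varepsilon_lP_l$ lies in `lowSpan l`, so only its pairings with $P_m$ for
$m<l$ matter. Moving $E$ to the other side gives $P_l$ against a vector in the span of the $m_\mu$
with $\mu\le m<l$, which is zero. No separation of eigenvalues is used. -/
theorem IsTri.apply_jackP {n : ℕ} {E : Sym →ₗ[F] Sym} {ε : Ptn → F} (hE : IsTri n E ε) {l : Ptn}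
    (hl : l.weight = n) : E (jackP l) = ε l • jackP l := by
  have key : ∀ m : Ptn, m.weight = n →
      E (jackP m) - ε m • jackP m ∈ lowSpan m := by
    intro m hm
    have h1 := jackP_sub_mem m
    have h2 := hE.mem_lowSpan hm h1
    rw [map_sub] at h2
    have h3 := add_mem (sub_mem h2 (Submodule.smul_mem _ (ε m) h1)) (hE.apply_mP_sub_mem hm)
    have h4 : E (jackP m) - E (mP m) - ε m • (jackP m - mP m) +
        (E (mP m) - ε m • mP m) = E (jackP m) - ε m • jackP m := by
      rw [smul_sub]
      abel
    rwa [h4] at h3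
  rw [← sub_eq_zero]
  refine eq_of_form_jackP fun m => ?_
  rw [map_zero, LinearMap.zero_apply]
  by_cases hml : m.StrictDom l
  · have hm := hml.1.1.trans hl
    have h1 : form (jackP l) (E (jackP m) - ε m • jackP m) = 0 :=
      form_jackP_of_mem_lowSpan (key m hm) fun h => h.2 (h.1.antisymm hml.1)
    have h2 := form_jackP (Ne.symm hml.2)
    rw [map_sub, map_smul, h2, smul_zero, sub_zero, ← hE.1] at h1
    rw [map_sub, LinearMap.sub_apply, h1, map_smul, LinearMap.smul_apply, h2, smul_zero, sub_zero]
  · rw [form_comm]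
    exact form_jackP_of_mem_lowSpan (key l hl) hml

theorem lap_jackP (l : Ptn) : lap l.weight (jackP l) = e' l • jackP l :=
  (isTri_lap l.weight).apply_jackP rfl

theorem form_jackQ_jackP (l m : Ptn) : form (jackQ l) (jackP m) = if l = m then 1 else 0 := by
  rw [jackQ, map_smul, LinearMap.smul_apply, smul_eq_mul]
  split_ifs with h
  · rw [h, ← form_apply, inv_mul_cancel₀ (form_jackP_self_ne_zero m)]
  · rw [form_jackP h, mul_zero]

/-! ### Moving up filtrations -/

namespace Filtration

/-- The filtration of length zero. -/
def triv (l : Ptn) : Filtration := ⟨0, fun _ => l, fun i => i.elim0⟩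

/-- Prolonging a filtration at its start. -/
def cons (l : Ptn) (δ : Filtration) (h : δ.st ∈ l.movingUp) : Filtration where
  s := δ.s + 1
  seq := Fin.cons l δ.seq
  step := fun i => by
    refine Fin.cases ?_ (fun k => ?_) i
    · exact h
    · exact δ.step k

@[simp] theorem st_triv (l : Ptn) : (triv l).st = l := rfl

@[simp] theorem ed_triv (l : Ptn) : (triv l).ed = l := rfl

@[simp] theorem ed_cons (l : Ptn) (δ : Filtration) (h : δ.st ∈ l.movingUp) :
    (cons l δ h).ed = δ.ed := rfl

theorem fUpper_triv (m l : Ptn) : fUpper m (triv l) = 1 := Fin.prod_univ_zero _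

theorem fLower_triv (m l : Ptn) : fLower m (triv l) = 1 := Fin.prod_univ_zero _

theorem fUpper_cons (m l : Ptn) (δ : Filtration) (h : δ.st ∈ l.movingUp) :
    fUpper m (cons l δ h) = r l δ.st / (e' m - e' l) * fUpper m δ :=
  Fin.prod_univ_succ (n := δ.s) _

theorem fLower_cons (m l : Ptn) (δ : Filtration) (h : δ.st ∈ l.movingUp) :
    fLower m (cons l δ h) = r l δ.st / (e' m - e' δ.st) * fLower m δ :=
  Fin.prod_univ_succ (n := δ.s) _

theorem cons_inj {l : Ptn} {δ δ' : Filtration} {h : δ.st ∈ l.movingUp} {h' : δ'.st ∈ l.movingUp}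
    (heq : cons l δ h = cons l δ' h') : δ = δ' := by
  obtain ⟨s, seq, step⟩ := δ
  obtain ⟨s', seq', step'⟩ := δ'
  simp only [cons, mk.injEq] at heq
  obtain ⟨h1, h2⟩ := heq
  obtain rfl : s = s' := Nat.succ_injective h1
  obtain rfl : seq = seq' := Fin.cons_right_injective (α := fun _ => Ptn) l (eq_of_heq h2)
  rfl

theorem eq_triv_or_eq_cons (δ : Filtration) :
    δ = triv δ.st ∨ ∃ δ' h, δ = cons δ.st δ' h := by
  obtain ⟨s, seq, step⟩ := δ
  cases s with
  | zero =>
    left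
    simp only [triv, st, mk.injEq, heq_eq_eq, true_and]
    funext i
    exact congrArg seq (Fin.fin_one_eq_zero i)
  | succ s =>
    right
    refine ⟨⟨s, fun i => seq i.succ, fun i => step i.succ⟩, step 0, ?_⟩
    simp only [cons, st, mk.injEq, heq_eq_eq, true_and]
    exact (Fin.cons_self_tail (α := fun _ => Ptn) seq).symm

theorem cons_ne_triv (l m : Ptn) (δ : Filtration) (h : δ.st ∈ l.movingUp) :
    cons l δ h ≠ triv m := fun heq => Nat.succ_ne_zero _ (congrArg Filtration.s heq)

/-- A nontrivial filtration is a move followed by a filtration starting strictly higher, and each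
partition has finitely many moves. -/
theorem finite_st (l : Ptn) : {δ : Filtration | δ.st = l}.Finite := by
  induction l using Ptn.dominance_induction_down with
  | H l ih =>
    have hfin : (⋃ m ∈ l.upper, {δ : Filtration | δ.st = m}).Finite :=
      Set.Finite.biUnion l.upper.finite_toSet fun m hm => ih m (Ptn.strictDom_of_mem_upper hm)
    refine ((hfin.image fun δ => if h : δ.st ∈ l.movingUp then cons l δ h else δ).insert
      (triv l)).subset ?_
    rintro δ rfl
    rcases eq_triv_or_eq_cons δ with h | ⟨δ', h', h⟩
    · exact Or.inl h
    · refine Or.inr ⟨δ', Set.mem_biUnion (Ptn.mem_upper.2 h') rfl, ?_⟩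
      simp only [dif_pos h']
      exact h.symm

/-- The filtrations with a given start. -/
def starting (l : Ptn) : Finset Filtration := (finite_st l).toFinset

theorem mem_starting {l : Ptn} {δ : Filtration} : δ ∈ starting l ↔ δ.st = l :=
  (finite_st l).mem_toFinset

/-- Decomposition by the first step. The function `H` stands for `G` after prolongation by `l`, so
that the proof of `δ.st ∈ l.movingUp` stays out of the sum. -/
theorem sum_starting {M : Type*} [AddCommMonoid M] (l : Ptn) (G H : Filtration → M)
    (hGH : ∀ δ h, G (cons l δ h) = H δ) :
    ∑ δ ∈ starting l, G δ = G (triv l) + ∑ m ∈ l.upper, ∑ δ ∈ starting m, H δ := by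
  rw [← Finset.add_sum_erase _ _ (mem_starting.2 (st_triv l)), Finset.sum_sigma']
  congr 1
  symm
  have hst : ∀ x ∈ l.upper.sigma starting, x.2.st ∈ l.movingUp := by
    intro x hx
    rw [Finset.mem_sigma, mem_starting] at hx
    rw [hx.2]
    exact Ptn.mem_upper.1 hx.1
  refine Finset.sum_bij (fun x hx => cons l x.2 (hst x hx)) ?_ ?_ ?_ ?_
  · intro x hx
    exact Finset.mem_erase.2 ⟨cons_ne_triv _ _ _ _, mem_starting.2 rfl⟩
  · rintro ⟨m, δ⟩ hx ⟨m', δ'⟩ hx' heq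
    obtain rfl := cons_inj heq
    rw [Finset.mem_sigma, mem_starting] at hx hx'
    obtain rfl : m = m' := hx.2.symm.trans hx'.2
    rfl
  · intro δ hδ
    rw [Finset.mem_erase, mem_starting] at hδ
    obtain ⟨h1, rfl⟩ := hδ
    obtain ⟨δ', h', h⟩ := (eq_triv_or_eq_cons δ).resolve_left h1
    exact ⟨⟨δ'.st, δ'⟩, Finset.mem_sigma.2 ⟨Ptn.mem_upper.2 h', mem_starting.2 rfl⟩, h.symm⟩
  · intro x hx
    exact (hGH _ _).symm

end Filtration

/-! ### Expansion of the Jack functions along filtrations -/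

open Filtration

theorem not_dominated_of_strictDom {k l m : Ptn} (h : k.StrictDom m) (hk : ¬ k.StrictDom l) :
    ¬ m.Dominated l := fun h' => hk (h.trans_right h')

/-- The coefficients of the Jack functions on the `m_ν`. -/
theorem form_gP_jackP_eq_sum (l k : Ptn) :
    form (gP k) (jackP l) =
      ∑ δ ∈ starting k, if δ.ed = l then fUpper l δ else 0 := by
  induction k using Ptn.dominance_induction_down with
  | H k ih =>
    have hrec : (∑ δ ∈ starting k, if δ.ed = l then fUpper l δ else 0) =
        (if k = l then 1 else 0) +
          ∑ m ∈ k.upper, r k m / (e' l - e' k) * form (gP m) (jackP l) := by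
      rw [sum_starting k _ (fun δ => r k δ.st / (e' l - e' k) *
        if δ.ed = l then fUpper l δ else 0) (fun δ h => by
          rw [ed_cons, fUpper_cons, mul_ite, mul_zero]), fUpper_triv, ed_triv]
      congr 1
      refine Finset.sum_congr rfl fun m hm => ?_
      rw [ih m (Ptn.strictDom_of_mem_upper hm), Finset.mul_sum]
      exact Finset.sum_congr rfl fun δ hδ => by rw [mem_starting.1 hδ]
    rw [hrec]
    by_cases hkl : k.StrictDom l
    · have hne := sub_ne_zero.2 (e'_ne hkl).symm
      -- Computing $\langle Dg_k,P_l\rangle$ on either side gives $(e'_l-e'_k)\langle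
      -- g_k,P_l\rangle=\sum_m r_{km}\langle g_m,P_l\rangle$.
      have h1 := form_lap k.weight (gP k) (jackP l)
      rw [hkl.1.1, lap_jackP, ← hkl.1.1, lap_gP, map_smul, map_add, LinearMap.add_apply, map_smul,
        LinearMap.smul_apply, map_sum, LinearMap.sum_apply, smul_eq_mul, smul_eq_mul,
        ← eq_sub_iff_add_eq', ← sub_mul] at h1
      rw [if_neg hkl.2, zero_add]
      refine mul_left_cancel₀ hne ?_
      rw [← h1, Finset.mul_sum]
      refine Finset.sum_congr rfl fun m _ => ?_
      rw [map_smul, LinearMap.smul_apply, smul_eq_mul, ← mul_assoc, mul_div_cancel₀ _ hne]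
    -- Here $e'_l-e'_k$ may vanish, but no `m` above `k` is dominated by `l`, so every term is
    -- killed by $\langle g_m,P_l\rangle=0$.
    · rw [Finset.sum_eq_zero, add_zero]
      · split_ifs with h
        · rw [h, form_gP_jackP_self]
        · exact form_gP_jackP fun h' => hkl ⟨h', h⟩
      · intro m hm
        rw [form_gP_jackP (not_dominated_of_strictDom (Ptn.strictDom_of_mem_upper hm) hkl),
          mul_zero]

/-- The sum of the `g_{ed δ}` over the filtrations `δ` starting at `l`, with the weights
`f_m(δ)`. -/
def pathSum (m l : Ptn) : Sym := ∑ δ ∈ starting l, fLower m δ • gP δ.ed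

theorem pathSum_eq (m l : Ptn) :
    pathSum m l = gP l + ∑ k ∈ l.upper, (r l k / (e' m - e' k)) • pathSum m k := by
  rw [pathSum, sum_starting l _ (fun δ => (r l δ.st / (e' m - e' δ.st)) • fLower m δ • gP δ.ed)
    (fun δ h => by rw [ed_cons, fLower_cons, mul_smul]), fLower_triv, ed_triv, one_smul]
  congr 1
  refine Finset.sum_congr rfl fun k _ => ?_
  rw [pathSum, Finset.smul_sum]
  exact Finset.sum_congr rfl fun δ hδ => by rw [mem_starting.1 hδ]

theorem upSpan_mono {l m : Ptn} (h : l.Dominated m) : upSpan m ≤ upSpan l :=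
  Submodule.span_mono fun _ ⟨k, hk, hk'⟩ => ⟨k, hk.trans_left h, hk'⟩

theorem pathSum_sub_mem (m l : Ptn) : pathSum m l - gP l ∈ upSpan l := by
  induction l using Ptn.dominance_induction_down with
  | H l ih =>
    rw [pathSum_eq, add_sub_cancel_left]
    refine Submodule.sum_mem _ fun k hk => Submodule.smul_mem _ _ ?_
    have hlk := Ptn.strictDom_of_mem_upper hk
    rw [← sub_add_cancel (pathSum m k) (gP k)]
    exact add_mem (upSpan_mono hlk.1 (ih k hlk)) (Submodule.subset_span ⟨k, hlk, rfl⟩)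

/-- The denominators $e'_m-e'_k$ are chosen so that the defect $(e'_k-e'_m)g_k$ of each continuation
cancels the term $r_{lk}g_k$ of $Dg_l$. Only the defect at the start survives, and it vanishes for
`l = m`. -/
theorem lap_pathSum {m l : Ptn} (h : m.Dominated l) :
    lap m.weight (pathSum m l) = e' m • pathSum m l + (e' l - e' m) • gP l := by
  induction l using Ptn.dominance_induction_down with
  | H l ih =>
    rw [pathSum_eq, map_add, h.1, lap_gP, ← h.1, map_sum, smul_add, sub_smul, add_assoc,
      add_right_comm (e' m • gP l), add_sub_cancel, add_right_inj, Finset.smul_sum,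
      ← Finset.sum_add_distrib]
    refine Finset.sum_congr rfl fun k hk => ?_
    have hlk := Ptn.strictDom_of_mem_upper hk
    have hne := sub_ne_zero.2 (e'_ne (hlk.trans_left h))
    rw [map_smul, ih k hlk (h.trans hlk.1), smul_add, smul_comm (e' m), smul_smul _ (e' k - e' m),
      ← neg_sub (e' m), mul_neg, div_mul_cancel₀ _ hne, neg_smul]
    abel

/-- The expansion of `Q_λ` in the `g_μ`. -/
theorem jackQ_eq_pathSum (l : Ptn) : jackQ l = pathSum l l := by
  refine eq_of_form_jackP fun k => ?_
  rw [form_jackQ_jackP]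
  -- Above `l` the pairing vanishes because $D$ has different eigenvalues on the two sides; for all
  -- other `k` only the leading term $g_l$ of the path sum can contribute.
  by_cases hlk : l.StrictDom k
  · have h1 := form_lap l.weight (pathSum l l) (jackP k)
    rw [lap_pathSum (Ptn.Dominated.refl l), sub_self, zero_smul, add_zero, hlk.1.1, lap_jackP,
      map_smul, map_smul, LinearMap.smul_apply, ← sub_eq_zero, ← sub_smul] at h1
    rw [if_neg hlk.2]
    exact ((smul_eq_zero.1 h1).resolve_left (sub_ne_zero.2 (e'_ne hlk))).symm
  · rw [← sub_add_cancel (pathSum l l) (gP l), map_add, LinearMap.add_apply,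
      form_eq_zero_of_mem_upSpan (pathSum_sub_mem l l) fun m hm =>
        form_gP_jackP (not_dominated_of_strictDom hm hlk), zero_add]
    split_ifs with h
    · rw [h, form_gP_jackP_self]
    · exact (form_gP_jackP fun h' => hlk ⟨h', h⟩).symm

/-! ### The product formula -/

theorem gP_union (l m : Ptn) : gP (l.union m) = gP l * gP m := gM_add _ _

theorem form_jackQ_mul_jackQ (m n l : Ptn) :
    form (jackQ m * jackQ n) (jackP l) = ∑ a ∈ starting m, ∑ b ∈ starting n,
      ∑ c ∈ (starting (a.ed.union b.ed)).filter (fun δ => δ.ed = l),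
        a.fLower m * b.fLower n * c.fUpper l := by
  rw [jackQ_eq_pathSum, jackQ_eq_pathSum, pathSum, pathSum, Finset.sum_mul_sum, map_sum,
    LinearMap.sum_apply]
  refine Finset.sum_congr rfl fun a _ => ?_
  rw [map_sum, LinearMap.sum_apply]
  refine Finset.sum_congr rfl fun b _ => ?_
  rw [smul_mul_smul_comm, ← gP_union, map_smul, LinearMap.smul_apply, form_gP_jackP_eq_sum,
    smul_eq_mul, ← Finset.sum_filter, Finset.mul_sum]

/-- Besides being part of the theorem, finiteness makes the `∑ᶠ` over the triples a genuine sum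
rather than the default value 0. -/
theorem finite_triples (m n l : Ptn) : (triples m n l).Finite := by
  refine Set.Finite.subset (Finset.finite_toSet ((starting m).biUnion fun a =>
    (starting n).biUnion fun b => (starting (a.ed.union b.ed)).image fun c => (a, b, c))) ?_
  rintro ⟨a, b, c⟩ ⟨h1, h2, -, h4⟩
  simp only [Finset.coe_biUnion, Set.mem_iUnion, Finset.mem_coe, Finset.mem_image]
  exact ⟨a, mem_starting.2 h1, b, mem_starting.2 h2, c, mem_starting.2 h4, rfl⟩

theorem finsum_triples (m n l : Ptn) :
    ∑ᶠ t ∈ triples m n l, t.1.fLower m * t.2.1.fLower n * t.2.2.fUpper l =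
      form (jackQ m * jackQ n) (jackP l) := by
  rw [form_jackQ_mul_jackQ, finsum_mem_eq_finite_toFinset_sum _ (finite_triples m n l)]
  have hstep : ∀ a : Filtration, ∑ b ∈ starting n,
      ∑ c ∈ (starting (a.ed.union b.ed)).filter (fun δ => δ.ed = l),
        a.fLower m * b.fLower n * c.fUpper l =
      ∑ p ∈ (starting n).biUnion fun b => ((starting (a.ed.union b.ed)).filter
        (fun δ => δ.ed = l)).image fun c => (b, c),
        a.fLower m * p.1.fLower n * p.2.fUpper l := by
    intro a
    symm
    refine Finset.sum_finset_product' _ _ _ (f := fun b c : Filtration =>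
      a.fLower m * b.fLower n * c.fUpper l) fun p => ?_
    obtain ⟨b, c⟩ := p
    simp
  rw [Finset.sum_congr rfl fun a _ => hstep a]
  refine Finset.sum_finset_product' _ _ _ (f := fun (a : Filtration) (p : Filtration × Filtration) =>
    a.fLower m * p.1.fLower n * p.2.fUpper l) fun p => ?_
  obtain ⟨a, b, c⟩ := p
  simp only [Set.Finite.mem_toFinset, triples, Set.mem_ofPred_eq, Finset.mem_biUnion,
    Finset.mem_image, Finset.mem_filter, mem_starting, Prod.mk.injEq]
  constructor
  · rintro ⟨h1, h2, h3, h4⟩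
    exact ⟨h1, b, h2, c, ⟨h4, h3⟩, rfl, rfl⟩
  · rintro ⟨h1, b', h2, c', ⟨h4, h3⟩, rfl, rfl⟩
    exact ⟨h1, h2, h3, h4⟩

/-- Since $P_l$ has coefficient 1 at $m_l$, $v_{ll}$ is the normalizing scalar itself and
$J_l=v_{ll}P_l$. The identity needs no information on the denominator. -/
theorem v_self (l : Ptn) :
    v l l = (Nat.factorial l.weight : F) / mCoeff (Ptn.ones l.weight) (jackP l) := by
  rw [v, mCoeff_eq, jackJ, map_smul, form_gP_jackP_self, smul_eq_mul, mul_one]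

end

end JackLR

theorem theorem5p7 (μ ν lam : JackLR.Ptn) :
    (JackLR.triples μ ν lam).Finite ∧
    JackLR.inner (JackLR.jackQ μ * JackLR.jackQ ν) (JackLR.jackJ lam) =
      JackLR.v lam lam *
        ∑ᶠ t ∈ JackLR.triples μ ν lam,
          t.1.fLower μ * t.2.1.fLower ν * t.2.2.fUpper lam := by
  refine ⟨JackLR.finite_triples μ ν lam, ?_⟩
  rw [JackLR.finsum_triples, JackLR.v_self, JackLR.jackJ, ← JackLR.form_apply, map_smul,
    smul_eq_mul]
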